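/- **Notation.** Partitions are identified with Young diagrams; the node in row $a$ and column $b$ has residue $b-a$ modulo $2$. For $i\in\{0,1\}$ let $A_i(\lambda)$ be the set of addable nodes of $\lambda$ of residue $i$, and let $a_i(\lambda,x)$ and $r_i(\lambda,x)$ be the numbers of addable and removable nodes of $\lambda$ of residue $i$ strictly to the right of the node $x$. Let $\mathcal F_q$ be the free $\mathbb Z[q,q^{-1}]$-module on the partitions of all non-negative integers, with divided power operators $$F_i^{(k)}\colon\lambda\mapsto\sum_{X\subseteq A_i(\lambda),\,|X|=k}q^{\sum_{x\in X}(a_i(\lambda\cup X,x)-r_i(\lambda,x))}\cdot(\lambda\cup X)\qquad(i\in\{0,1\},\ k\ge 0).$$ Let $\mathcal U$ be the $\mathbb Z[q,q^{-1}]$-algebra generated by the $F_i^{(k)}$, and $\mathcal L=[\,]\cdot\mathcal U$ the submodule generated by the empty partition $[\,]$. The bar involution of $\mathcal U$ is the ring involution with $q\mapsto q^{-1}$ fixing all $F_i^{(k)}$; it induces the involution $[\,]\cdot u\mapsto[\,]\cdot\bar u$ of $\mathcal L$. The global crystal basis is the unique $\mathbb Z[q,q^{-1}]$-basis $(B^\mu)$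 of $\mathcal L$, indexed by the $2$-regular partitions $\mu$ (those with distinct parts), such that $\overline{B^\mu}=B^\mu$ and $B^\mu-\mu$ has all its coefficients in $q\mathbb Z[q]$. Write $B^\mu=\sum_\lambda b_{\lambda,\mu}(q)\,\lambda$. Let $\mathcal F_q^{>4}$ be the span of the partitions $\lambda$ with $\lambda_1<|\lambda|-4$. For a partition $\lambda=[\lambda_1,\lambda_2,\dots]$ of $n$ we write $\lambda=(\lambda_2,\lambda_3,\dots)$, omitting the first part, and we let $\delta_i=1$ if $n\equiv i\pmod 2$ and $\delta_i=0$ otherwise. **Theorem** (crystallized decomposition matrix for $p=2$). Let $\mu$ be a $2$-regular partition of $n$ with $\mu_1\ge n-4$. (1) Let $n\ge 5,5,7,7,6,9,8$ according to whether $\mu=(),(1),(2),(3),(2,1),(4),(3,1)$; for $n\ge 8$ this is no restriction. Then, modulo $\mathcal F_q^{>4}$, $$\begin{array}{lcl} B^{()}&\equiv&()+q\delta_0(1)+q(1^2)+q^2\delta_0(1^3)+q^2(1^4),\\ B^{(1)}&\equiv&(1)+q\delta_0(2)+q^2\delta_0(1^2)+q(1^3)+q^2\delta_0(2,1^2)+q^3\delta_0(1^4),\\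 B^{(2)}&\equiv&(2)+q(1^2)+q\delta_0(3)+q^2\delta_1(2,1)+q^2\delta_0(1^3)+q\delta_0(3,1)+q^2\delta_0(2^2)+(q+q^3\delta_0)(2,1^2)+q^2(1^4),\\ B^{(3)}&\equiv&(3)+q(1^3)+q\delta_0(4)+q^2\delta_0(3,1)+q^2\delta_0(2,1^2)+q^3\delta_0(1^4),\\ B^{(2,1)}&\equiv&(2,1)+q\delta_1(3,1)+q^2\delta_1(2^2)+q^3\delta_1(2,1^2),\\ B^{(4)}&\equiv&(4)+q(3,1)+q(2,1^2)+q^2(1^4),\\ B^{(3,1)}&\equiv&(3,1)+q(2^2)+q^2(2,1^2). \end{array}$$ (2) Consequently, for $n\ge 8$ and all partitions $\lambda$ of $n$ with $\lambda_1\ge n-4$, the entry $b_{\lambda,\mu}(q)$ of the crystallized decomposition matrix $\mathcal D^q_n(\le 4)$ is the coefficient of $\lambda$ in the above list. (3) For $n\ge 8$, in terms of the round bracket notation for $\lambda$ and $\mu$, the entry $b_{\lambda,\mu}(q)$ depends only on $n$ modulo $2$. (4) In the situation of (1), the right hand side of the list is the unique element $v$ of $\mathcal F_q/\mathcal F_q^{>4}$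 which is the image of a bar-invariant element of $\mathcal L$ and satisfies $v\equiv\mu$ modulo the image of $q\mathbb Z[q]\otimes_{\mathbb Z}\mathcal F$, where $\mathcal F$ is the free abelian group on all partitions; that is, $v=\mu+y+\mathcal F_q^{>4}$ for some $y\in\mathcal F_q$ with all coefficients in $q\mathbb Z[q]$. -/

import Mathlib

open scoped LaurentPolynomial

namespace FockSpace

/-! ### Partitions, addable and removable nodes

A partition is a Young diagram; nodes `(a, b)` are counted from `(0, 0)`, so that the residue
of a node is `b - a` modulo `p` as usual. -/

/-- `μ` is `p`-regular: every part occurs less than `p` times. -/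
def IsPRegular (p : ℕ) (μ : YoungDiagram) : Prop :=
  ∀ x ∈ μ.rowLens, μ.rowLens.count x < p

/-- The `p`-regular partitions, of all non-negative integers. -/
abbrev RegularPartition (p : ℕ) : Type := {μ : YoungDiagram // IsPRegular p μ}

/-- The tail `[λ₂, λ₃, …]` of the partition `[λ₁, λ₂, λ₃, …]`. -/
def tail (l : YoungDiagram) : List ℕ := l.rowLens.tail

/-- The `p`-residue of a node. -/
def residue (p : ℕ) (x : ℕ × ℕ) : ZMod p := (x.2 : ZMod p) - (x.1 : ZMod p)

/-- All addable nodes of `l`: at the end of a row `a` (the first empty row included) which is the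
first row or is shorter than the row before it. -/
def addable (l : YoungDiagram) : Finset (ℕ × ℕ) :=
  ((Finset.range (l.colLen 0 + 1)).filter
    (fun a => a = 0 ∨ l.rowLen a < l.rowLen (a - 1))).image (fun a => (a, l.rowLen a))

/-- All removable nodes of `l`: the last nodes of those rows `a` which are longer than the next
row. -/
def removable (l : YoungDiagram) : Finset (ℕ × ℕ) :=
  ((Finset.range (l.colLen 0)).filter
    (fun a => l.rowLen (a + 1) < l.rowLen a)).image (fun a => (a, l.rowLen a - 1))

/-- The addable `i`-nodes. -/
def addableRes (p : ℕ) (i : ZMod p) (l : YoungDiagram) : Finset (ℕ × ℕ) :=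
  (addable l).filter (fun x => residue p x = i)

/-- The removable `i`-nodes. -/
def removableRes (p : ℕ) (i : ZMod p) (l : YoungDiagram) : Finset (ℕ × ℕ) :=
  (removable l).filter (fun x => residue p x = i)

/-- The number of addable `i`-nodes strictly to the right of `x`. -/
def addableRight (p : ℕ) (i : ZMod p) (l : YoungDiagram) (x : ℕ × ℕ) : ℕ :=
  ((addableRes p i l).filter (fun y => x.2 < y.2)).card

/-- The number of removable `i`-nodes strictly to the right of `x`. -/
def removableRight (p : ℕ) (i : ZMod p) (l : YoungDiagram) (x : ℕ × ℕ) : ℕ :=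
  ((removableRes p i l).filter (fun y => x.2 < y.2)).card

/-- The union of `l` with a set of addable nodes is again a Young diagram. -/
theorem isLowerSet_union (l : YoungDiagram) (X : Finset (ℕ × ℕ)) (hX : X ⊆ addable l) :
    IsLowerSet ((l.cells ∪ X : Finset (ℕ × ℕ)) : Set (ℕ × ℕ)) := by
  rintro ⟨a, b⟩ ⟨c, d⟩ hle hab
  obtain ⟨hca, hdb⟩ := Prod.mk_le_mk.1 hle
  simp only [Finset.coe_union, Set.mem_union, Finset.mem_coe, YoungDiagram.mem_cells] at hab ⊢
  rcases hab with hab | hab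
  · exact Or.inl (l.up_left_mem hca hdb hab)
  · have h := hX hab
    simp only [addable, Finset.mem_image, Finset.mem_filter, Finset.mem_range,
      Prod.mk.injEq] at h
    obtain ⟨a', ⟨-, h0⟩, rfl, rfl⟩ := h
    rcases hca.lt_or_eq with hlt | rfl
    · left
      rw [YoungDiagram.mem_iff_lt_rowLen]
      rcases h0 with h0 | h0
      · omega
      · have := l.rowLen_anti c (a' - 1) (by omega)
        omega
    · rcases hdb.lt_or_eq with hlt | rfl
      · left
        rw [YoungDiagram.mem_iff_lt_rowLen]
        exact hlt
      · exact Or.inr hab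

open Classical in
/-- The partition `l ∪ X`, for a set `X` of addable nodes of `l` (and `l` itself if `l ∪ X` is
not a Young diagram, which does not happen for sets of addable nodes). -/
noncomputable def addNodes (l : YoungDiagram) (X : Finset (ℕ × ℕ)) : YoungDiagram :=
  if h : IsLowerSet ((l.cells ∪ X : Finset (ℕ × ℕ)) : Set (ℕ × ℕ)) then ⟨l.cells ∪ X, h⟩ else l

theorem cells_addNodes (l : YoungDiagram) (X : Finset (ℕ × ℕ)) (hX : X ⊆ addable l) :
    (addNodes l X).cells = l.cells ∪ X := by
  rw [addNodes, dif_pos (isLowerSet_union l X hX)]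

/-! ### The Fock space and the divided power operators -/

/-- The Fock space over `ℤ[q, q⁻¹]`, free on the partitions of all non-negative integers. The
indeterminate `q` is `LaurentPolynomial.T 1`. -/
abbrev Fock : Type := YoungDiagram →₀ ℤ[T;T⁻¹]

/-- A partition as an element of the Fock space. -/
noncomputable def ket (l : YoungDiagram) : Fock := Finsupp.single l 1

/-- The divided power operator `F_i^{(k)}`: it maps `l` to the sum, over the `k`-element sets `X`
of addable `i`-nodes of `l`, of `q ^ (∑ x ∈ X, (a_i(l ∪ X, x) - r_i(l, x))) • (l ∪ X)`. -/
noncomputable def divPow (p : ℕ) (i : ZMod p) (k : ℕ) : Module.End ℤ[T;T⁻¹] Fock :=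
  Finsupp.linearCombination ℤ[T;T⁻¹] (fun l : YoungDiagram =>
    ∑ X ∈ (addableRes p i l).powersetCard k,
      (LaurentPolynomial.T (∑ x ∈ X,
        ((addableRight p i (addNodes l X) x : ℤ) - (removableRight p i l x : ℤ))) : ℤ[T;T⁻¹]) •
        ket (addNodes l X))

/-- The algebra `U` generated by the divided power operators. -/
noncomputable def algU (p : ℕ) : Subalgebra ℤ[T;T⁻¹] (Module.End ℤ[T;T⁻¹] Fock) :=
  Algebra.adjoin ℤ[T;T⁻¹] (Set.range fun ik : ZMod p × ℕ => divPow p ik.1 ik.2)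

/-- The `U`-submodule of the Fock space generated by the empty partition. -/
noncomputable def latL (p : ℕ) : Submodule ℤ[T;T⁻¹] Fock :=
  (Subalgebra.toSubmodule (algU p)).map (LinearMap.applyₗ (ket ⊥))

/-- The graph of the bar involution `u ↦ ū` of `U`, that is of the ring involution with
`q ↦ q⁻¹` that fixes the divided power operators: the ring of pairs generated by the pairs
`(F_i^{(k)}, F_i^{(k)})` and `(f, f̄)` for `f ∈ ℤ[q, q⁻¹]`. -/
noncomputable def barGraph (p : ℕ) :
    Subring (Module.End ℤ[T;T⁻¹] Fock × Module.End ℤ[T;T⁻¹] Fock) :=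
  Subring.closure
    ((Set.range fun ik : ZMod p × ℕ => (divPow p ik.1 ik.2, divPow p ik.1 ik.2)) ∪
     (Set.range fun f : ℤ[T;T⁻¹] =>
      (algebraMap ℤ[T;T⁻¹] (Module.End ℤ[T;T⁻¹] Fock) f,
       algebraMap ℤ[T;T⁻¹] (Module.End ℤ[T;T⁻¹] Fock) (LaurentPolynomial.invert f))))

/-- `x` is an element of the module generated by the empty partition that is fixed by the bar
involution `[]·u ↦ []·ū` of this module. -/
def IsBarInvariant (p : ℕ) (x : Fock) : Prop :=
  ∃ u ∈ barGraph p, u.1 (ket ⊥) = x ∧ u.2 (ket ⊥) = x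

/-- `x ∈ qℤ[q] ⊗ 𝓕`: all coefficients of `x` are polynomials in `q` without constant term. -/
def InQLattice (x : Fock) : Prop :=
  ∀ l : YoungDiagram, ∃ g : Polynomial ℤ, x l = Polynomial.toLaurent (Polynomial.X * g)

/-- `B` is the global crystal basis: the unique family of bar-invariant elements, indexed by the
`p`-regular partitions, which is a `ℤ[q, q⁻¹]`-basis of the module generated by the empty
partition and satisfies `B^μ - μ ∈ qℤ[q] ⊗ 𝓕`. -/
structure IsGlobalCrystalBasis (p : ℕ) (B : RegularPartition p → Fock) : Prop where
  linearIndependent : LinearIndependent ℤ[T;T⁻¹] B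
  span_eq : Submodule.span ℤ[T;T⁻¹] (Set.range B) = latL p
  barInvariant : ∀ μ, IsBarInvariant p (B μ)
  congr : ∀ μ, InQLattice (B μ - ket μ.1)

/-! ### The truncated Fock space -/

/-- `l` lies in `𝓟_n(≤ m)`, where `n = |l|`: its largest part is at least `n - m`. -/
def InTrunc (m : ℕ) (l : YoungDiagram) : Prop := l.card ≤ l.rowLen 0 + m

/-- The submodule `𝓕^{>m}` spanned by the partitions of any `n` with largest part less than
`n - m`. -/
noncomputable def fockGT (m : ℕ) : Submodule ℤ[T;T⁻¹] Fock :=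
  Submodule.span ℤ[T;T⁻¹] (ket '' {l | ¬ InTrunc m l})

/-! ### The table, for `p = 2` and `m = 4` -/

/-- The partitions of `0, 1, 2, 3, 4`: the tails of the partitions in `𝓟_n(≤ 4)`. -/
def tails : Finset (List ℕ) :=
  {[], [1], [2], [1, 1], [3], [2, 1], [1, 1, 1], [4], [3, 1], [2, 2], [2, 1, 1], [1, 1, 1, 1]}

open Classical in
/-- The partition `[n - |t|, t₁, t₂, …]` of `n` with tail `t`, as an element of the Fock space;
it is `0` if there is no such partition, that is if `n - |t| < t₁`. -/
noncomputable def bracket (n : ℕ) (t : List ℕ) : Fock :=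
  if h : ((n - t.sum) :: t).SortedGE then ket (YoungDiagram.ofRowLens ((n - t.sum) :: t) h) else 0

/-- The indeterminate. -/
noncomputable def q : ℤ[T;T⁻¹] := LaurentPolynomial.T 1

/-- `1` if `n ≡ i` modulo `2`, and `0` otherwise. -/
noncomputable def delta (i n : ℕ) : ℤ[T;T⁻¹] := if n % 2 = i then 1 else 0

/-- The entry of the table in the row with tail `r` and the column with tail `c`. -/
noncomputable def entry (n : ℕ) (r c : List ℕ) : ℤ[T;T⁻¹] :=
  match c with
  | [] =>
    match r with
    | [] => 1
    | [1] => q * delta 0 n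
    | [1, 1] => q
    | [1, 1, 1] => q ^ 2 * delta 0 n
    | [1, 1, 1, 1] => q ^ 2
    | _ => 0
  | [1] =>
    match r with
    | [1] => 1
    | [2] => q * delta 0 n
    | [1, 1] => q ^ 2 * delta 0 n
    | [1, 1, 1] => q
    | [2, 1, 1] => q ^ 2 * delta 0 n
    | [1, 1, 1, 1] => q ^ 3 * delta 0 n
    | _ => 0
  | [2] =>
    match r with
    | [2] => 1
    | [1, 1] => q
    | [3] => q * delta 0 n
    | [2, 1] => q ^ 2 * delta 1 n
    | [1, 1, 1] => q ^ 2 * delta 0 n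
    | [3, 1] => q * delta 0 n
    | [2, 2] => q ^ 2 * delta 0 n
    | [2, 1, 1] => q + q ^ 3 * delta 0 n
    | [1, 1, 1, 1] => q ^ 2
    | _ => 0
  | [3] =>
    match r with
    | [3] => 1
    | [1, 1, 1] => q
    | [4] => q * delta 0 n
    | [3, 1] => q ^ 2 * delta 0 n
    | [2, 1, 1] => q ^ 2 * delta 0 n
    | [1, 1, 1, 1] => q ^ 3 * delta 0 n
    | _ => 0
  | [2, 1] =>
    match r with
    | [2, 1] => 1
    | [3, 1] => q * delta 1 n
    | [2, 2] => q ^ 2 * delta 1 n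
    | [2, 1, 1] => q ^ 3 * delta 1 n
    | _ => 0
  | [4] =>
    match r with
    | [4] => 1
    | [3, 1] => q
    | [2, 1, 1] => q
    | [1, 1, 1, 1] => q ^ 2
    | _ => 0
  | [3, 1] =>
    match r with
    | [3, 1] => 1
    | [2, 2] => q
    | [2, 1, 1] => q ^ 2
    | _ => 0
  | _ => 0

/-- The column of the table with tail `c`, as an element of the Fock space. -/
noncomputable def column (n : ℕ) (c : List ℕ) : Fock :=
  ∑ r ∈ tails, entry n r c • bracket n r

/-- The bound from which on the column with tail `c` is given by the table. -/
def lowerBound (c : List ℕ) : ℕ :=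
  match c with
  | [] => 5
  | [1] => 5
  | [2] => 7
  | [3] => 7
  | [2, 1] => 6
  | [4] => 9
  | [3, 1] => 8
  | _ => 0

end FockSpace

/-!
The operators `F_i^{(k)}` do not decrease `|λ| - λ₁`, so they act on the quotient of the Fock space
by `𝓕^{>4}`, which in degree `n` has the partitions `[n - |t|, t]` with `|t| ≤ 4` as a basis. As
neighbouring nodes have different residues, `A_i(λ ∪ X) = A_i(λ) \ X` for a set `X` of addable
`i`-nodes; hence all exponents of `q` can be computed from the rows of `λ` that end in addable or
removable `i`-nodes (`divPow_ket`). From `n = 10` on, the result only depends on the tail `t` and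
on the parity of `n` (`tailDivPow_red`), so that statements about the action of the operators on
the columns of the table are finite computations. Two of them suffice. In both, the columns `C_c`
for small `n` (below the bounds in the theorem) are the table with four terms left out, and all
congruences are modulo `𝓕^{>4}`.

* Each `F_i^{(k)} C_c` is a combination of columns whose coefficients are invariant under
  `q ↦ q⁻¹` (`divPow_colVec`).
* Each column of degree `N > 0` is some `F_i^{(k)} C_c`, for a column `C_c` of smaller degree,
  up to a combination of later columns of degree `N` with such coefficients
  (`exists_divPow_sub_mem`).

By the second statement, each column is congruent to a bar-invariant element
(`isBarInvariantModGT_colVec`). The first one controls the bar involution: the pairs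
`(∑ f_c C_c, ∑ f̄_c C_c)` modulo `𝓕^{>4}` contain `([], [])` and are preserved by the graph of the
bar involution of `U` (`BarPair.barGraph`). So a bar-invariant element `z` is congruent both to
`∑ f_c C_c` and to `∑ f̄_c C_c`. If the truncation of `z` lies in the `qℤ[q]`-lattice, then all
`f_c` and all `f̄_c` are in `qℤ[q]`, because `C_c` is a partition modulo `qℤ[q]`
(`orderGE_one_of_sum`); thus `f_c = 0` and `z ∈ 𝓕^{>4}` (`IsBarInvariant.mem_fockGT`). This is the
uniqueness in the last part of the theorem, and the elements of the global crystal basis are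
instances of it.
-/

open scoped LaurentPolynomial

namespace FockSpace

/-! ### A computable model of the truncated operators -/

/-- The rows `r ≤ N` of the partition with row lengths `f` that end in an addable node of
residue `i` modulo `2`. -/
def addRows (f : ℕ → ℕ) (N i : ℕ) : List ℕ :=
  (List.range (N + 1)).filter fun r => (r = 0 ∨ f r < f (r - 1)) ∧ (f r + r) % 2 = i

/-- The rows `r < N` of the partition with row lengths `f` whose last node is removable of
residue `i` modulo `2`. -/
def remRows (f : ℕ → ℕ) (N i : ℕ) : List ℕ :=
  (List.range N).filter fun r => f (r + 1) < f r ∧ (f r + r + 1) % 2 = i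

/-- The exponent of `q` for adding nodes in the rows `S`, where `A` and `R` are the rows with
addable and removable nodes. A node lies to the right of another one of the same residue if and
only if its row is smaller, and the addable nodes of the enlarged partition are those of `A`
outside `S`. -/
def expo (A R S : List ℕ) : ℤ :=
  (S.map fun s => ((A.filter fun y => y ∉ S ∧ y < s).length : ℤ) -
    ((R.filter fun y => y < s).length : ℤ)).sum

/-- Adds a node to each of the rows `S` of the list of row lengths `t`, whose first row has
index `r`. -/
def bump (S : List ℕ) : ℕ → List ℕ → List ℕ
  | r, [] => if r ∈ S then [1] else []
  | r, x :: t => (x + if r ∈ S then 1 else 0) :: bump S (r + 1) t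

/-- The row lengths of the partition of `n` with tail `t`. -/
def rowFun (n : ℕ) (t : List ℕ) (r : ℕ) : ℕ := ((n - t.sum) :: t).getD r 0

/-- The terms `(exponent, tail)` of the divided power `F_i^{(k)}` applied to the partition of `n`
with tail `t`. -/
def tailDivPow (i k n : ℕ) (t : List ℕ) : List (ℤ × List ℕ) :=
  let A := addRows (rowFun n t) (t.length + 1) i
  let R := remRows (rowFun n t) (t.length + 1) i
  (A.sublistsLen k).map fun S => (expo A R S, bump S 1 t)

/-- A Laurent polynomial, as a list of terms `(coefficient, exponent)`. -/
abbrev Poly : Type := List (ℤ × ℤ)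

/-- An element of the Fock space homogeneous of some degree, as a list of terms
`(coefficient, exponent, tail)`. -/
abbrev Comb : Type := List (ℤ × ℤ × List ℕ)

/-- The product of a Laurent polynomial and a combination. -/
def mulComb (p : Poly) (x : Comb) : Comb :=
  p.flatMap fun a => x.map fun z => (a.1 * z.1, a.2 + z.2.1, z.2.2)

/-- The divided power `F_i^{(k)}` on combinations in degree `n`, without the terms whose tail is
a partition of more than `4`. -/
def combDivPow (i k n : ℕ) (x : Comb) : Comb :=
  x.flatMap fun z => ((tailDivPow i k n z.2.2).filter fun w => w.2.sum ≤ 4).map fun w =>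
    (z.1, z.2.1 + w.1, w.2)

/-- Adds a term to a combination, merging it with the term of the same exponent and tail. -/
def insertTerm (z : ℤ × ℤ × List ℕ) : Comb → Comb
  | [] => [z]
  | w :: x =>
    if w.2 = z.2 then (if w.1 + z.1 = 0 then x else (w.1 + z.1, w.2) :: x)
    else w :: insertTerm z x

/-- Collects the terms of a combination with the same exponent and tail. -/
def collect (x : Comb) : Comb := x.foldr insertTerm []

/-- The coefficient of the tail `c` in a combination. -/
def coeffAt (c : List ℕ) (x : Comb) : Poly :=
  (x.filter fun z => z.2.2 = c).map fun z => (z.1, z.2.1)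

/-- The image of a Laurent polynomial under `q ↦ q⁻¹`. -/
def invPoly (p : Poly) : Poly := p.map fun a => (a.1, -a.2)

/-- The negative of a Laurent polynomial. -/
def negPoly (p : Poly) : Poly := p.map fun a => (-a.1, a.2)

/-- The tails of the partitions in question, as a list. -/
def tailList : List (List ℕ) :=
  [[], [1], [2], [1, 1], [3], [2, 1], [1, 1, 1], [4], [3, 1], [2, 2], [2, 1, 1], [1, 1, 1, 1]]

/-- The tails of the `2`-regular partitions in question, in an order for which the columns are
unitriangular. -/
def regTails : List (List ℕ) := [[], [1], [2], [3], [2, 1], [4], [3, 1]]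

/-- The tails of the `2`-regular partitions of `n` in question. -/
def colsAt (n : ℕ) : List (List ℕ) :=
  regTails.filter fun c => c = [] ∨ c.sum + c.headD 0 < n

/-- The entry of the table in the row with tail `r` and the column with tail `c`, as a list of
terms. Below the bound from which on the table gives the canonical basis, four terms have to be
left out. -/
def entryPoly (n : ℕ) (r c : List ℕ) : Poly :=
  let d (j : ℕ) (e : ℤ) : Poly := if n % 2 = j then [(1, e)] else []
  match c with
  | [] =>
    match r with
    | [] => [(1, 0)]
    | [1] => d 0 1
    | [1, 1] => [(1, 1)]
    | [1, 1, 1] => d 0 2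
    | [1, 1, 1, 1] => [(1, 2)]
    | _ => []
  | [1] =>
    match r with
    | [1] => [(1, 0)]
    | [2] => d 0 1
    | [1, 1] => d 0 2
    | [1, 1, 1] => if n = 4 then [] else [(1, 1)]
    | [2, 1, 1] => d 0 2
    | [1, 1, 1, 1] => d 0 3
    | _ => []
  | [2] =>
    match r with
    | [2] => [(1, 0)]
    | [1, 1] => [(1, 1)]
    | [3] => d 0 1
    | [2, 1] => d 1 2
    | [1, 1, 1] => d 0 2
    | [3, 1] => d 0 1
    | [2, 2] => d 0 2
    | [2, 1, 1] => (if n = 6 then [] else [(1, 1)]) ++ d 0 3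
    | [1, 1, 1, 1] => if n ≤ 6 then [] else [(1, 2)]
    | _ => []
  | [3] =>
    match r with
    | [3] => [(1, 0)]
    | [1, 1, 1] => [(1, 1)]
    | [4] => d 0 1
    | [3, 1] => d 0 2
    | [2, 1, 1] => d 0 2
    | [1, 1, 1, 1] => d 0 3
    | _ => []
  | [2, 1] =>
    match r with
    | [2, 1] => [(1, 0)]
    | [3, 1] => d 1 1
    | [2, 2] => d 1 2
    | [2, 1, 1] => d 1 3
    | _ => []
  | [4] =>
    match r with
    | [4] => [(1, 0)]
    | [3, 1] => [(1, 1)]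
    | [2, 1, 1] => [(1, 1)]
    | [1, 1, 1, 1] => [(1, 2)]
    | _ => []
  | [3, 1] =>
    match r with
    | [3, 1] => [(1, 0)]
    | [2, 2] => [(1, 1)]
    | [2, 1, 1] => [(1, 2)]
    | _ => []
  | _ => []

/-- The column with tail `c` in degree `n`, as a combination. -/
def colComb (n : ℕ) (c : List ℕ) : Comb :=
  (tailList.filter fun r => r.sum + r.headD 0 ≤ n).flatMap fun r =>
    (entryPoly n r c).map fun a => (a.1, a.2, r)

/-- A degree below `12` with the same truncated combinatorics as `n`: from degree `10` on, only
the parity matters. -/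
def red (n : ℕ) : ℕ := if n < 10 then n else 10 + n % 2

/-- Decides, by elimination, whether a combination is a combination of the columns `cs` with
coefficients invariant under `q ↦ q⁻¹`. -/
def spans (n : ℕ) : List (List ℕ) → Comb → Bool
  | [], x => x.isEmpty
  | c :: cs, x =>
    let p := coeffAt c x
    (invPoly p).isPerm p && spans n cs (collect (x ++ mulComb (negPoly p) (colComb n c)))

/-- Decides whether `F_i^{(k)}` maps the columns of degree `n` to combinations of columns with
coefficients invariant under `q ↦ q⁻¹`. -/
def columnsStable (n : ℕ) : Bool :=
  (colsAt n).all fun c => (List.range 2).all fun i => (List.range 7).all fun k =>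
    spans (red (n + k)) (colsAt (red (n + k))) (collect (combDivPow i k n (colComb n c)))

/-- Decides whether each column of degree `n` is some `F_i^{(k)}` of a column of degree `n - k`,
up to a combination of later columns with coefficients invariant under `q ↦ q⁻¹`; only `k = 1` is
allowed beyond degree `10`. -/
def columnsReached (n : ℕ) : Bool :=
  (colsAt n).all fun c => [1, 2].any fun k => (List.range 2).any fun i =>
    (k ≤ n && (n ≤ 10 || k = 1)) && (colsAt (n - k)).any fun c' =>
      spans (red n) ((colsAt n).filter fun c'' => regTails.idxOf c < regTails.idxOf c'')
        (collect (combDivPow i k (n - k) (colComb (n - k) c') ++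
          mulComb [(-1, 0)] (colComb (red n) c)))

theorem columnsStable_all : (List.range 12).all columnsStable = true := by decide +kernel

theorem columnsReached_all : ((List.range 12).all fun n => columnsReached (n + 1)) = true := by
  decide +kernel

/-! ### Divided powers in terms of rows -/

theorem rowLen_eq_zero {l : YoungDiagram} {r : ℕ} (h : l.colLen 0 ≤ r) : l.rowLen r = 0 := by
  by_contra h0
  have h1 : (r, 0) ∈ l := YoungDiagram.mem_iff_lt_rowLen.2 (by omega)
  have h2 := YoungDiagram.mem_iff_lt_colLen.1 h1
  omega

theorem mem_addable {l : YoungDiagram} {x : ℕ × ℕ} :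
    x ∈ addable l ↔ (x.1 = 0 ∨ l.rowLen x.1 < l.rowLen (x.1 - 1)) ∧ x.2 = l.rowLen x.1 := by
  obtain ⟨r, c⟩ := x
  simp only [addable, Finset.mem_image, Finset.mem_filter, Finset.mem_range, Prod.mk.injEq]
  constructor
  · rintro ⟨a, ⟨-, h⟩, rfl, rfl⟩
    exact ⟨h, rfl⟩
  · rintro ⟨h, rfl⟩
    refine ⟨r, ⟨?_, h⟩, rfl, rfl⟩
    by_contra h1
    have := rowLen_eq_zero (l := l) (r := r - 1) (by omega)
    omega

theorem mem_removable {l : YoungDiagram} {x : ℕ × ℕ} :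
    x ∈ removable l ↔ l.rowLen (x.1 + 1) < l.rowLen x.1 ∧ x.2 = l.rowLen x.1 - 1 := by
  obtain ⟨r, c⟩ := x
  simp only [removable, Finset.mem_image, Finset.mem_filter, Finset.mem_range, Prod.mk.injEq]
  constructor
  · rintro ⟨a, ⟨-, h⟩, rfl, rfl⟩
    exact ⟨h, rfl⟩
  · rintro ⟨h, rfl⟩
    refine ⟨r, ⟨?_, h⟩, rfl, rfl⟩
    by_contra h1
    have := rowLen_eq_zero (l := l) (r := r) (by omega)
    omega

theorem residue_two_eq_iff (r c : ℕ) (i : ZMod 2) :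
    residue 2 (r, c) = i ↔ (c + r) % 2 = i.val := by
  have h1 : residue 2 (r, c) = ((c + r : ℕ) : ZMod 2) := by
    simp only [residue, Nat.cast_add, sub_eq_add_neg, ZMod.neg_eq_self_mod_two]
  rw [h1, ← ZMod.val_natCast]
  exact ⟨fun h => by rw [h], fun h => ZMod.val_injective 2 h⟩

theorem mem_addableRes {l : YoungDiagram} {x : ℕ × ℕ} {i : ZMod 2} :
    x ∈ addableRes 2 i l ↔ ((x.1 = 0 ∨ l.rowLen x.1 < l.rowLen (x.1 - 1)) ∧
      (l.rowLen x.1 + x.1) % 2 = i.val) ∧ x.2 = l.rowLen x.1 := by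
  obtain ⟨r, c⟩ := x
  simp only [addableRes, Finset.mem_filter, mem_addable, residue_two_eq_iff]
  constructor
  · rintro ⟨⟨h, rfl⟩, h2⟩
    exact ⟨⟨h, h2⟩, rfl⟩
  · rintro ⟨⟨h, h2⟩, rfl⟩
    exact ⟨⟨h, rfl⟩, h2⟩

theorem mem_removableRes {l : YoungDiagram} {x : ℕ × ℕ} {i : ZMod 2} :
    x ∈ removableRes 2 i l ↔ (l.rowLen (x.1 + 1) < l.rowLen x.1 ∧
      (l.rowLen x.1 + x.1 + 1) % 2 = i.val) ∧ x.2 = l.rowLen x.1 - 1 := by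
  obtain ⟨r, c⟩ := x
  simp only [removableRes, Finset.mem_filter, mem_removable, residue_two_eq_iff]
  constructor
  · rintro ⟨⟨h, rfl⟩, h2⟩
    exact ⟨⟨h, by omega⟩, rfl⟩
  · rintro ⟨⟨h, h2⟩, rfl⟩
    exact ⟨⟨h, rfl⟩, by omega⟩

/-- The node that is added to the row `r`. -/
def endNode (l : YoungDiagram) : ℕ ↪ ℕ × ℕ where
  toFun r := (r, l.rowLen r)
  inj' _ _ h := (Prod.mk.inj h).1

/-- The node at the end of the row `r`. -/
def lastNode (l : YoungDiagram) : ℕ ↪ ℕ × ℕ where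
  toFun r := (r, l.rowLen r - 1)
  inj' _ _ h := (Prod.mk.inj h).1

theorem endNode_apply (l : YoungDiagram) (r : ℕ) : endNode l r = (r, l.rowLen r) := rfl

theorem lastNode_apply (l : YoungDiagram) (r : ℕ) : lastNode l r = (r, l.rowLen r - 1) := rfl

theorem mem_addRows {f : ℕ → ℕ} {N i r : ℕ} : r ∈ addRows f N i ↔
    r < N + 1 ∧ (r = 0 ∨ f r < f (r - 1)) ∧ (f r + r) % 2 = i := by
  simp [addRows]

theorem mem_remRows {f : ℕ → ℕ} {N i r : ℕ} : r ∈ remRows f N i ↔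
    r < N ∧ f (r + 1) < f r ∧ (f r + r + 1) % 2 = i := by
  simp [remRows]

theorem nodup_addRows (f : ℕ → ℕ) (N i : ℕ) : (addRows f N i).Nodup :=
  List.nodup_range.filter _

theorem nodup_remRows (f : ℕ → ℕ) (N i : ℕ) : (remRows f N i).Nodup :=
  List.nodup_range.filter _

theorem addableRes_eq_map (l : YoungDiagram) (N : ℕ) (hN : l.colLen 0 ≤ N) (i : ZMod 2) :
    addableRes 2 i l = (addRows l.rowLen N i.val).toFinset.map (endNode l) := by
  ext ⟨r, c⟩
  simp only [mem_addableRes, Finset.mem_map, List.mem_toFinset, mem_addRows, endNode_apply,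
    Prod.mk.injEq]
  constructor
  · rintro ⟨h, rfl⟩
    refine ⟨r, ⟨?_, h⟩, rfl, rfl⟩
    by_contra h1
    have := rowLen_eq_zero (l := l) (r := r - 1) (by omega)
    omega
  · rintro ⟨a, ⟨-, h⟩, rfl, rfl⟩
    exact ⟨h, rfl⟩

theorem removableRes_eq_map (l : YoungDiagram) (N : ℕ) (hN : l.colLen 0 ≤ N) (i : ZMod 2) :
    removableRes 2 i l = (remRows l.rowLen N i.val).toFinset.map (lastNode l) := by
  ext ⟨r, c⟩
  simp only [mem_removableRes, Finset.mem_map, List.mem_toFinset, mem_remRows, lastNode_apply,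
    Prod.mk.injEq]
  constructor
  · rintro ⟨h, rfl⟩
    refine ⟨r, ⟨?_, h⟩, rfl, rfl⟩
    by_contra h1
    have := rowLen_eq_zero (l := l) (r := r) (by omega)
    omega
  · rintro ⟨a, ⟨-, h⟩, rfl, rfl⟩
    exact ⟨h, rfl⟩

/-- The row lengths after adding nodes to the rows in `S`. -/
theorem rowLen_addNodes (l : YoungDiagram) (S : Finset ℕ) (hS : S.map (endNode l) ⊆ addable l)
    (r : ℕ) : (addNodes l (S.map (endNode l))).rowLen r = l.rowLen r + if r ∈ S then 1 else 0 := by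
  refine eq_of_forall_lt_iff fun c => ?_
  rw [← YoungDiagram.mem_iff_lt_rowLen, ← YoungDiagram.mem_cells, cells_addNodes _ _ hS,
    Finset.mem_union, YoungDiagram.mem_cells, YoungDiagram.mem_iff_lt_rowLen]
  simp only [Finset.mem_map, endNode_apply, Prod.mk.injEq]
  constructor
  · rintro (h | ⟨a, h, rfl, rfl⟩)
    · omega
    · simp [h]
  · intro h
    split_ifs at h with hr
    · rcases (Nat.lt_succ_iff_lt_or_eq.1 h) with h | h
      · exact Or.inl h
      · exact Or.inr ⟨r, hr, rfl, h.symm⟩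
    · exact Or.inl h

/-- Adding nodes of residue `i` neither creates nor destroys other addable nodes of residue `i`,
as neighbouring nodes have different residues. -/
theorem addableRes_addNodes (l : YoungDiagram) (i : ZMod 2) (S : Finset ℕ)
    (hS : S.map (endNode l) ⊆ addableRes 2 i l) :
    addableRes 2 i (addNodes l (S.map (endNode l))) =
      addableRes 2 i l \ S.map (endNode l) := by
  have hS' : S.map (endNode l) ⊆ addable l := hS.trans (Finset.filter_subset _ _)
  have hmem : ∀ s ∈ S, (s = 0 ∨ l.rowLen s < l.rowLen (s - 1)) ∧
      (l.rowLen s + s) % 2 = i.val := fun s hs =>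
    (mem_addableRes.1 (hS (Finset.mem_map_of_mem _ hs))).1
  ext ⟨r, c⟩
  simp only [mem_addableRes, Finset.mem_sdiff, rowLen_addNodes l S hS', Finset.mem_map,
    endNode_apply, Prod.mk.injEq]
  by_cases hr : r ∈ S
  · have h1 := (hmem r hr).2
    simp only [hr, if_true]
    constructor
    · rintro ⟨⟨-, h⟩, -⟩
      omega
    · rintro ⟨⟨-, rfl⟩, h⟩
      exact (h ⟨r, hr, rfl, rfl⟩).elim
  · simp only [hr, if_false, add_zero]
    have h2 : ¬ ∃ a ∈ S, a = r ∧ l.rowLen a = c := by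
      rintro ⟨a, ha, rfl, -⟩
      exact hr ha
    simp only [h2, not_false_eq_true, and_true]
    refine and_congr_left fun _ => and_congr_left fun h3 => or_congr_right' fun h0 => ?_
    split_ifs with h4
    · have h5 := (hmem _ h4).2
      have h6 := l.rowLen_anti (r - 1) r (by omega)
      omega
    · simp

theorem right_addable_iff {l : YoungDiagram} {r s : ℕ}
    (hs : s = 0 ∨ l.rowLen s < l.rowLen (s - 1)) :
    l.rowLen s < l.rowLen r ↔ r < s := by
  constructor
  · intro h
    by_contra h1
    have := l.rowLen_anti s r (by omega)
    omega
  · intro h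
    have := l.rowLen_anti r (s - 1) (by omega)
    omega

/-- A removable node of residue `i` in the row above an addable one cannot lie in the same column:
the two would have different residues. -/
theorem right_removable_iff {l : YoungDiagram} {i r s : ℕ}
    (hs : s = 0 ∨ l.rowLen s < l.rowLen (s - 1)) (hsi : (l.rowLen s + s) % 2 = i)
    (hr : l.rowLen (r + 1) < l.rowLen r) (hri : (l.rowLen r + r + 1) % 2 = i) :
    l.rowLen s < l.rowLen r - 1 ↔ r < s := by
  constructor
  · intro h
    by_contra h1
    have := l.rowLen_anti s r (by omega)
    omega
  · intro h
    have h1 := l.rowLen_anti r (s - 1) (by omega)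
    rcases (show r + 1 ≤ s from h).eq_or_lt with rfl | h2
    · omega
    · have := l.rowLen_anti (r + 1) (s - 1) (by omega)
      omega

/-- The exponents in the definition of the divided powers, in terms of rows. -/
theorem exponent_eq_expo (l : YoungDiagram) (N : ℕ) (hN : l.colLen 0 ≤ N) (i : ZMod 2)
    (L : List ℕ) (hL : L.Sublist (addRows l.rowLen N i.val)) :
    (∑ x ∈ L.toFinset.map (endNode l),
      ((addableRight 2 i (addNodes l (L.toFinset.map (endNode l))) x : ℤ) -
        (removableRight 2 i l x : ℤ))) =
    expo (addRows l.rowLen N i.val) (remRows l.rowLen N i.val) L := by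
  have hnd : L.Nodup := (nodup_addRows _ _ _).sublist hL
  have hsub : L.toFinset.map (endNode l) ⊆ addableRes 2 i l := by
    rw [addableRes_eq_map l N hN]
    exact Finset.map_subset_map.2 fun x hx =>
      List.mem_toFinset.2 (hL.subset (List.mem_toFinset.1 hx))
  rw [Finset.sum_map, List.sum_toFinset _ hnd, expo]
  congr 1
  refine List.map_congr_left fun s hs => ?_
  have hs1 := (mem_addRows.1 (hL.subset hs)).2
  congr 2
  · rw [addableRight, addableRes_addNodes l i _ hsub, addableRes_eq_map l N hN,
      ← Finset.map_sdiff, Finset.filter_map, Finset.card_map,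
      ← List.toFinset_card_of_nodup ((nodup_addRows _ _ _).filter _)]
    congr 1
    ext r
    refine Finset.mem_filter.trans ?_
    simp only [Finset.mem_sdiff, List.mem_toFinset, Function.comp_apply, endNode_apply,
      List.mem_filter, decide_eq_true_eq,
      right_addable_iff hs1.1]
    tauto
  · rw [removableRight, removableRes_eq_map l N hN, Finset.filter_map, Finset.card_map,
      ← List.toFinset_card_of_nodup ((nodup_remRows _ _ _).filter _)]
    congr 1
    ext r
    refine Finset.mem_filter.trans ?_
    simp only [List.mem_toFinset, Function.comp_apply, endNode_apply,
      lastNode_apply, List.mem_filter, decide_eq_true_eq]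
    refine and_congr_right fun hr => ?_
    have hr1 := (mem_remRows.1 hr).2
    exact right_removable_iff hs1.1 hs1.2 hr1.1 hr1.2

theorem sum_powersetCard_toFinset {α M : Type*} [DecidableEq α] [AddCommMonoid M] (L : List α)
    (hL : L.Nodup) (k : ℕ) (g : Finset α → M) :
    ∑ S ∈ L.toFinset.powersetCard k, g S =
      ((L.sublistsLen k).map fun S => g S.toFinset).sum := by
  have h1 : g = (fun m : Multiset α => g m.toFinset) ∘ Finset.val := by
    ext s
    simp
  rw [Finset.sum, h1, ← Multiset.map_map,
    Finset.map_val_val_powersetCard, List.toFinset_val, hL.dedup, Multiset.powersetCard_coe,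
    Multiset.map_coe, Multiset.sum_coe, List.map_map]
  refine congrArg List.sum (List.map_congr_left fun S _ => congrArg g ?_)
  ext
  simp

/-- The divided power operators in terms of rows. -/
theorem divPow_ket (l : YoungDiagram) (N : ℕ) (hN : l.colLen 0 ≤ N) (i : ZMod 2) (k : ℕ) :
    divPow 2 i k (ket l) = (((addRows l.rowLen N i.val).sublistsLen k).map fun S =>
      (LaurentPolynomial.T
        (expo (addRows l.rowLen N i.val) (remRows l.rowLen N i.val) S) : ℤ[T;T⁻¹]) •
        ket (addNodes l (S.toFinset.map (endNode l)))).sum := by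
  rw [divPow, ket, Finsupp.linearCombination_single, one_smul, addableRes_eq_map l N hN,
    Finset.powersetCard_map, Finset.sum_map, sum_powersetCard_toFinset _ (nodup_addRows _ _ _)]
  congr 1
  refine List.map_congr_left fun S hS => ?_
  simp only [RelEmbedding.coe_toEmbedding, Finset.mapEmbedding_apply]
  rw [exponent_eq_expo l N hN i S (List.mem_sublistsLen.1 hS).1]

/-! ### Partitions in bracket notation -/

theorem rowLen_ofRowLens_eq_getD (w : List ℕ) (h : w.SortedGE) (r : ℕ) :
    (YoungDiagram.ofRowLens w h).rowLen r = w.getD r 0 := by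
  by_cases hr : r < w.length
  · rw [List.getD_eq_getElem _ _ hr]
    exact YoungDiagram.rowLen_ofRowLens (hw := h) ⟨r, hr⟩
  · rw [List.getD_eq_default _ _ (by omega)]
    by_contra h0
    have h1 : (r, 0) ∈ YoungDiagram.ofRowLens w h := YoungDiagram.mem_iff_lt_rowLen.2 (by omega)
    obtain ⟨h2, -⟩ := YoungDiagram.mem_ofRowLens.1 h1
    exact hr h2

theorem colLen_ofRowLens_le (w : List ℕ) (h : w.SortedGE) :
    (YoungDiagram.ofRowLens w h).colLen 0 ≤ w.length := by
  by_contra h0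
  have h1 : (w.length, 0) ∈ YoungDiagram.ofRowLens w h :=
    YoungDiagram.mem_iff_lt_colLen.2 (by omega)
  obtain ⟨h2, -⟩ := YoungDiagram.mem_ofRowLens.1 h1
  exact lt_irrefl _ h2

theorem ext_rowLen {l m : YoungDiagram} (h : ∀ r, l.rowLen r = m.rowLen r) : l = m := by
  apply YoungDiagram.ext
  ext ⟨r, c⟩
  rw [YoungDiagram.mem_cells, YoungDiagram.mem_cells, YoungDiagram.mem_iff_lt_rowLen,
    YoungDiagram.mem_iff_lt_rowLen, h]

theorem card_cellsOfRowLens (w : List ℕ) : (YoungDiagram.cellsOfRowLens w).card = w.sum := by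
  induction w with
  | nil => rfl
  | cons a w ih =>
    rw [YoungDiagram.cellsOfRowLens, Finset.card_union_of_disjoint, Finset.card_map, ih,
      List.sum_cons]
    · simp
    · rw [Finset.disjoint_left]
      rintro ⟨r, c⟩ h1 h2
      simp only [Finset.mem_product, Finset.mem_singleton, Finset.mem_map,
        Function.Embedding.prodMap] at h1 h2
      obtain ⟨⟨r', c'⟩, -, h3⟩ := h2
      have := congrArg Prod.fst h3
      simp at this
      omega

theorem card_ofRowLens (w : List ℕ) (h : w.SortedGE) :
    (YoungDiagram.ofRowLens w h).card = w.sum :=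
  card_cellsOfRowLens w

theorem bracket_eq_ket {n : ℕ} {t : List ℕ} {μ : YoungDiagram}
    (h : ∀ r, rowFun n t r = μ.rowLen r) : bracket n t = ket μ := by
  have hs : ((n - t.sum) :: t).SortedGE := by
    refine List.sortedGE_of_getElem_ge_getElem_of_le fun i j hi hj hij => ?_
    have h1 := h i
    have h2 := h j
    rw [rowFun, List.getD_eq_getElem _ _ (by assumption)] at h1 h2
    rw [h1, h2]
    exact μ.rowLen_anti j i hij
  rw [bracket, dif_pos hs]
  congr 1
  exact ext_rowLen fun r => by rw [rowLen_ofRowLens_eq_getD, ← h r, rowFun]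

/-- `t` is the tail of a partition of `n`. -/
def IsTailOf (n : ℕ) (t : List ℕ) : Prop := t.sum ≤ n ∧ ((n - t.sum) :: t).SortedGE

theorem getD_bump (S : List ℕ) (r : ℕ) (t : List ℕ) (hS : ∀ s ∈ S, s ≤ r + t.length) (j : ℕ) :
    (bump S r t).getD j 0 = t.getD j 0 + if r + j ∈ S then 1 else 0 := by
  induction t generalizing r j with
  | nil =>
    cases j with
    | zero => by_cases h : r ∈ S <;> simp [bump, h]
    | succ j =>
      have h2 : r + (j + 1) ∉ S := fun h => by
        have := hS _ h
        simp at this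
      by_cases h : r ∈ S <;> simp [bump, h, h2]
  | cons x t ih =>
    cases j with
    | zero => simp [bump]
    | succ j =>
      have := ih (r + 1) (fun s hs => by have := hS s hs; simp at this; omega) j
      rw [show r + 1 + j = r + (j + 1) by ring] at this
      simpa [bump] using this

theorem card_filter_le_eq (s : Finset ℕ) (r : ℕ) : (s.filter fun x => r ≤ x).card =
    (if r ∈ s then 1 else 0) + (s.filter fun x => r + 1 ≤ x).card := by
  split_ifs with h
  · rw [add_comm, ← Finset.card_insert_of_notMem (a := r) (by simp)]
    congr 1
    ext x
    simp only [Finset.mem_filter, Finset.mem_insert]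
    constructor
    · rintro ⟨h1, h2⟩
      by_cases h3 : x = r
      · exact Or.inl h3
      · exact Or.inr ⟨h1, by omega⟩
    · rintro (rfl | ⟨h1, h2⟩)
      · exact ⟨h, le_rfl⟩
      · exact ⟨h1, by omega⟩
  · rw [zero_add]
    congr 1
    refine Finset.filter_congr fun x hx => ⟨fun h1 => ?_, fun h1 => by omega⟩
    have h2 : x ≠ r := fun h2 => h (h2 ▸ hx)
    omega

theorem sum_bump (S : List ℕ) (r : ℕ) (t : List ℕ) (hS : ∀ s ∈ S, s ≤ r + t.length) :
    (bump S r t).sum = t.sum + (S.toFinset.filter fun s => r ≤ s).card := by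
  induction t generalizing r with
  | nil =>
    have h0 : S.toFinset.filter (fun s => r + 1 ≤ s) = ∅ := by
      refine Finset.filter_eq_empty_iff.2 fun s hs => ?_
      have := hS s (List.mem_toFinset.1 hs)
      simp at this
      omega
    rw [card_filter_le_eq, h0, bump]
    split_ifs <;> simp_all
  | cons x t ih =>
    rw [card_filter_le_eq, bump, List.sum_cons, List.sum_cons, ih (r + 1) fun s hs => by
      have := hS s hs
      simp at this
      omega]
    simp only [List.mem_toFinset]
    omega

/-- The divided powers of a partition in bracket notation. -/
theorem divPow_bracket {n : ℕ} {t : List ℕ} (ht : IsTailOf n t) (i : ZMod 2) (k : ℕ) :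
    divPow 2 i k (bracket n t) = ((tailDivPow i.val k n t).map fun w =>
      (LaurentPolynomial.T w.1 : ℤ[T;T⁻¹]) • bracket (n + k) w.2).sum := by
  obtain ⟨hle, hs⟩ := ht
  have hrow : (YoungDiagram.ofRowLens _ hs).rowLen = rowFun n t :=
    funext fun r => rowLen_ofRowLens_eq_getD _ hs r
  rw [bracket, dif_pos hs, divPow_ket _ (t.length + 1) (colLen_ofRowLens_le _ hs), hrow,
    tailDivPow, List.map_map]
  congr 1
  refine List.map_congr_left fun S hS => ?_
  obtain ⟨hS, hlen⟩ := List.mem_sublistsLen.1 hS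
  have hnd : S.Nodup := (nodup_addRows _ _ _).sublist hS
  have hadd : S.toFinset.map (endNode (YoungDiagram.ofRowLens _ hs)) ⊆
      addable (YoungDiagram.ofRowLens _ hs) := by
    intro x hx
    obtain ⟨r, hr, rfl⟩ := Finset.mem_map.1 hx
    have h1 := (mem_addRows.1 (hS.subset (List.mem_toFinset.1 hr))).2.1
    rw [mem_addable, endNode_apply, hrow]
    exact ⟨h1, rfl⟩
  have hbd : ∀ s ∈ S, s ≤ 1 + t.length := fun s hs' => by
    have := (mem_addRows.1 (hS.subset hs')).1
    omega
  have hsum := sum_bump S 1 t hbd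
  have hcard := card_filter_le_eq S.toFinset 0
  have hk : S.toFinset.card = k := by rw [List.toFinset_card_of_nodup hnd, hlen]
  simp only [Nat.zero_le, Finset.filter_true, hk, List.mem_toFinset, zero_add] at hcard
  simp only [Function.comp_apply]
  congr 1
  symm
  refine bracket_eq_ket fun r => ?_
  rw [rowLen_addNodes _ _ hadd, hrow, rowFun, rowFun]
  simp only [List.mem_toFinset]
  cases r with
  | zero =>
    simp only [List.getD_cons_zero]
    omega
  | succ j =>
    simp only [List.getD_cons_succ]
    rw [getD_bump S 1 t hbd, add_comm 1 j]

/-! ### The submodule of truncated terms -/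

theorem mem_fockGT {m : ℕ} {x : Fock} : x ∈ fockGT m ↔ ∀ l, InTrunc m l → x l = 0 := by
  have h : fockGT m = Finsupp.supported ℤ[T;T⁻¹] ℤ[T;T⁻¹] {l | ¬ InTrunc m l} :=
    (Finsupp.supported_eq_span_single _ _).symm
  rw [h, Finsupp.mem_supported']
  simp

theorem bracket_mem_fockGT {n : ℕ} {t : List ℕ} (ht : 4 < t.sum) : bracket n t ∈ fockGT 4 := by
  rw [bracket]
  split_ifs with h
  · refine Submodule.subset_span ⟨_, ?_, rfl⟩
    simp only [Set.mem_ofPred_eq, InTrunc, card_ofRowLens, rowLen_ofRowLens_eq_getD,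
      List.sum_cons, List.getD_cons_zero]
    omega
  · exact Submodule.zero_mem _

theorem card_eq_rowLen_zero_add (l : YoungDiagram) :
    l.card = l.rowLen 0 + (l.cells.filter fun x => ¬ x.1 = 0).card := by
  rw [YoungDiagram.rowLen_eq_card, YoungDiagram.row, Finset.card_filter_add_card_filter_not]

theorem rowLen_zero_addNodes_le (l : YoungDiagram) (X : Finset (ℕ × ℕ)) (hX : X ⊆ addable l) :
    (addNodes l X).rowLen 0 + l.card ≤ l.rowLen 0 + (addNodes l X).card := by
  have h : (l.cells.filter fun x => ¬ x.1 = 0).card ≤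
      ((addNodes l X).cells.filter fun x => ¬ x.1 = 0).card := by
    rw [cells_addNodes l X hX]
    exact Finset.card_le_card (Finset.filter_subset_filter _ Finset.subset_union_left)
  have h1 := card_eq_rowLen_zero_add l
  have h2 := card_eq_rowLen_zero_add (addNodes l X)
  omega

/-- The divided powers preserve the truncation. -/
theorem divPow_mem_fockGT {i : ZMod 2} {k : ℕ} {x : Fock} {m : ℕ} (hx : x ∈ fockGT m) :
    divPow 2 i k x ∈ fockGT m := by
  induction hx using Submodule.span_induction with
  | zero => simp
  | add x y _ _ hx hy => rw [map_add]; exact Submodule.add_mem _ hx hy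
  | smul a x _ hx => rw [map_smul]; exact Submodule.smul_mem _ _ hx
  | mem x hx =>
    obtain ⟨l, hl, rfl⟩ := hx
    rw [divPow, ket, Finsupp.linearCombination_single, one_smul]
    refine Submodule.sum_mem _ fun X hX =>
      Submodule.smul_mem _ _ (Submodule.subset_span ⟨_, ?_, rfl⟩)
    have h1 := rowLen_zero_addNodes_le l X
      ((Finset.mem_powersetCard.1 hX).1.trans (Finset.filter_subset _ _))
    simp only [Set.mem_ofPred_eq, InTrunc] at hl ⊢
    omega

/-! ### Soundness of the computable model -/

/-- The Laurent polynomial with the given terms. -/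
noncomputable def evalPoly (p : Poly) : ℤ[T;T⁻¹] :=
  (p.map fun a => LaurentPolynomial.C a.1 * LaurentPolynomial.T a.2).sum

/-- The element of degree `n` of the Fock space with the given terms. -/
noncomputable def toFock (n : ℕ) (x : Comb) : Fock :=
  (x.map fun z => (LaurentPolynomial.C z.1 * LaurentPolynomial.T z.2.1 : ℤ[T;T⁻¹]) •
    bracket n z.2.2).sum

theorem toFock_nil (n : ℕ) : toFock n [] = 0 := rfl

theorem toFock_cons (n : ℕ) (z : ℤ × ℤ × List ℕ) (x : Comb) : toFock n (z :: x) =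
    (LaurentPolynomial.C z.1 * LaurentPolynomial.T z.2.1 : ℤ[T;T⁻¹]) • bracket n z.2.2 +
      toFock n x := by
  simp [toFock]

theorem toFock_append (n : ℕ) (x y : Comb) : toFock n (x ++ y) = toFock n x + toFock n y := by
  simp [toFock]

theorem toFock_perm (n : ℕ) {x y : Comb} (h : x.Perm y) : toFock n x = toFock n y :=
  (h.map _).sum_eq

theorem evalPoly_cons (a : ℤ × ℤ) (p : Poly) : evalPoly (a :: p) =
    LaurentPolynomial.C a.1 * LaurentPolynomial.T a.2 + evalPoly p := by
  simp [evalPoly]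

theorem toFock_insertTerm (n : ℕ) (z : ℤ × ℤ × List ℕ) (x : Comb) :
    toFock n (insertTerm z x) = toFock n (z :: x) := by
  induction x with
  | nil => rfl
  | cons w x ih =>
    rw [insertTerm]
    split_ifs with h1 h2
    · have h3 : z.1 = -w.1 := by omega
      simp only [toFock_cons, h1, h3, map_neg, neg_mul, neg_smul]
      abel
    · simp only [toFock_cons, h1, map_add, add_mul, add_smul]
      abel
    · rw [toFock_cons, ih]
      simp only [toFock_cons]
      abel

theorem toFock_collect (n : ℕ) (x : Comb) : toFock n (collect x) = toFock n x := by
  induction x with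
  | nil => rfl
  | cons z x ih =>
    rw [collect, List.foldr_cons, toFock_insertTerm, toFock_cons, toFock_cons, ← ih]
    rfl

theorem toFock_mulComb (n : ℕ) (p : Poly) (x : Comb) :
    toFock n (mulComb p x) = evalPoly p • toFock n x := by
  induction p with
  | nil => simp [mulComb, evalPoly, toFock]
  | cons a p ih =>
    have h1 : mulComb (a :: p) x =
        (x.map fun z => (a.1 * z.1, a.2 + z.2.1, z.2.2)) ++ mulComb p x := rfl
    rw [h1, toFock_append, ih, evalPoly_cons, add_smul]
    congr 1
    simp only [toFock, List.map_map, List.smul_sum]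
    congr 1
    refine List.map_congr_left fun z _ => ?_
    simp only [Function.comp_apply, smul_smul, map_mul, LaurentPolynomial.T_add]
    congr 1
    ring

theorem evalPoly_negPoly (p : Poly) : evalPoly (negPoly p) = -evalPoly p := by
  induction p with
  | nil => simp [negPoly, evalPoly]
  | cons a p ih =>
    have h1 : negPoly (a :: p) = (-a.1, a.2) :: negPoly p := rfl
    rw [h1, evalPoly_cons, evalPoly_cons, ih, map_neg]
    ring

theorem invert_evalPoly (p : Poly) :
    LaurentPolynomial.invert (evalPoly p) = evalPoly (invPoly p) := by
  induction p with
  | nil => simp [invPoly, evalPoly]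
  | cons a p ih =>
    have h1 : invPoly (a :: p) = (a.1, -a.2) :: invPoly p := rfl
    rw [h1, evalPoly_cons, evalPoly_cons, ← ih, map_add, map_mul, LaurentPolynomial.invert_C,
      LaurentPolynomial.invert_T]

theorem toFock_map_tail (n : ℕ) (p : Poly) (r : List ℕ) :
    toFock n (p.map fun a => (a.1, a.2, r)) = evalPoly p • bracket n r := by
  induction p with
  | nil => simp [evalPoly, toFock]
  | cons a p ih => rw [List.map_cons, toFock_cons, ih, evalPoly_cons, add_smul]

/-- The column with tail `c` in degree `n`, corrected in small degrees; modulo `𝓕^{>4}` these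
are the elements of the canonical basis. -/
noncomputable def colVec (n : ℕ) (c : List ℕ) : Fock := toFock n (colComb (red n) c)

/-- The combinations of the columns `cs` of degree `n` with coefficients invariant under
`q ↦ q⁻¹`. -/
noncomputable def barSpan (n : ℕ) (cs : List (List ℕ)) : AddSubgroup Fock :=
  AddSubgroup.closure {y | ∃ c ∈ cs, ∃ f : ℤ[T;T⁻¹], LaurentPolynomial.invert f = f ∧
    y = f • colVec n c}

theorem barSpan_mono {n : ℕ} {cs cs' : List (List ℕ)} (h : cs ⊆ cs') :
    barSpan n cs ≤ barSpan n cs' :=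
  AddSubgroup.closure_mono fun _ ⟨c, hc, h'⟩ => ⟨c, h hc, h'⟩

/-- Soundness of the elimination. It may be carried out in the reduced degree, since the columns are
given by the same combinations of tails there. -/
theorem toFock_mem_barSpan {n : ℕ} (cs : List (List ℕ)) (x : Comb)
    (h : spans (red n) cs x = true) : toFock n x ∈ barSpan n cs := by
  induction cs generalizing x with
  | nil =>
    rw [spans, List.isEmpty_iff] at h
    rw [h, toFock_nil]
    exact AddSubgroup.zero_mem _
  | cons c cs ih =>
    simp only [spans, Bool.and_eq_true] at h
    obtain ⟨h1, h2⟩ := h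
    have h3 := ih _ h2
    rw [toFock_collect, toFock_append, toFock_mulComb, evalPoly_negPoly, neg_smul] at h3
    have h4 : evalPoly (coeffAt c x) • colVec n c ∈ barSpan n (c :: cs) := by
      refine AddSubgroup.subset_closure ⟨c, List.mem_cons_self, _, ?_, rfl⟩
      rw [invert_evalPoly]
      exact ((List.isPerm_iff.1 h1).map _).sum_eq
    have h5 := AddSubgroup.add_mem _ (barSpan_mono (List.subset_cons_self c cs) h3) h4
    rw [colVec] at h5
    simpa using h5

/-! ### Dependence on the degree -/

theorem red_of_lt {n : ℕ} (h : n < 12) : red n = n := by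
  rw [red]
  split_ifs <;> omega

theorem red_lt (n : ℕ) : red n < 12 := by
  rw [red]
  split_ifs <;> omega

theorem red_red_add (n k : ℕ) : red (red n + k) = red (n + k) := by
  simp only [red]
  split_ifs <;> omega

theorem red_mod_two (n : ℕ) : red n % 2 = n % 2 := by
  simp only [red]
  split_ifs <;> omega

theorem le_red_iff {n m : ℕ} (h : m ≤ 10) : m ≤ red n ↔ m ≤ n := by
  simp only [red]
  split_ifs <;> omega

theorem getD_le_sum (t : List ℕ) (j : ℕ) : t.getD j 0 ≤ t.sum := by
  by_cases h : j < t.length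
  · rw [List.getD_eq_getElem _ _ h]
    exact List.le_sum_of_mem (List.getElem_mem h)
  · rw [List.getD_eq_default _ _ (by omega)]
    exact Nat.zero_le _

theorem tailDivPow_red (i k n : ℕ) (t : List ℕ) (ht : t.sum ≤ 4) :
    tailDivPow i k (red n) t = tailDivPow i k n t := by
  by_cases hn : n < 10
  · rw [red_of_lt (by omega)]
  have hr : 10 ≤ red n := (le_red_iff le_rfl).2 (by omega)
  have hmod := red_mod_two n
  have h0 : ∀ m, rowFun m t 0 = m - t.sum := fun m => rfl
  have hsucc : ∀ m j, rowFun m t (j + 1) = t.getD j 0 := fun m j => rfl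
  have ht1 := getD_le_sum t 0
  have hA : addRows (rowFun (red n) t) (t.length + 1) i =
      addRows (rowFun n t) (t.length + 1) i := by
    refine List.filter_congr fun r _ => decide_eq_decide.2 ?_
    rcases r with _ | _ | r
    · have hp : (red n - t.sum) % 2 = (n - t.sum) % 2 := by omega
      simp [h0, hp]
    · simp only [hsucc, zero_add, h0]
      have := hsucc (red n) 0
      have := hsucc n 0
      omega
    · simp only [hsucc, Nat.add_sub_cancel]
  have hR : remRows (rowFun (red n) t) (t.length + 1) i =
      remRows (rowFun n t) (t.length + 1) i := by
    refine List.filter_congr fun r _ => decide_eq_decide.2 ?_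
    rcases r with _ | r
    · simp only [hsucc, h0]
      omega
    · simp only [hsucc]
  simp only [tailDivPow, hA, hR]

theorem mem_colComb {n : ℕ} {c : List ℕ} {z : ℤ × ℤ × List ℕ} (hz : z ∈ colComb n c) :
    z.2.2 ∈ tailList ∧ z.2.2.sum + z.2.2.headD 0 ≤ n := by
  simp only [colComb, List.mem_flatMap, List.mem_filter, List.mem_map, decide_eq_true_eq] at hz
  obtain ⟨r, hr, a, -, rfl⟩ := hz
  exact hr

theorem isTailOf_of_mem_tailList {n : ℕ} {t : List ℕ} (ht : t ∈ tailList)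
    (hn : t.sum + t.headD 0 ≤ n) : IsTailOf n t := by
  refine ⟨by omega, ?_⟩
  rw [List.sortedGE_iff_isChain]
  have h1 : ∀ t ∈ tailList, List.IsChain (fun a b => a ≥ b) t := by decide
  have h2 := h1 t ht
  cases t with
  | nil => simp
  | cons a t =>
    rw [List.isChain_cons_cons]
    simp only [List.headD_cons] at hn
    exact ⟨by omega, h2⟩

theorem isTailOf_of_mem_colComb {n : ℕ} {c : List ℕ} {z : ℤ × ℤ × List ℕ}
    (hz : z ∈ colComb (red n) c) : IsTailOf n z.2.2 := by
  obtain ⟨h1, h2⟩ := mem_colComb hz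
  have h3 : ∀ t ∈ tailList, t.sum + t.headD 0 ≤ 10 := by decide
  exact isTailOf_of_mem_tailList h1 ((le_red_iff (h3 _ h1)).1 h2)

theorem sum_le_of_mem_tailList {t : List ℕ} (ht : t ∈ tailList) : t.sum ≤ 4 := by
  revert t
  decide

theorem length_le_of_mem_tailList {t : List ℕ} (ht : t ∈ tailList) : t.length ≤ 4 := by
  revert t
  decide

/-- Modulo `𝓕^{>4}`, the computable model of the divided powers is correct. -/
theorem divPow_toFock_sub_mem (i : ZMod 2) (k n : ℕ) (x : Comb)
    (hx : ∀ z ∈ x, IsTailOf n z.2.2) :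
    divPow 2 i k (toFock n x) - toFock (n + k) (combDivPow i.val k n x) ∈ fockGT 4 := by
  induction x with
  | nil => simp [combDivPow, toFock]
  | cons z x ih =>
    have ih := ih fun w hw => hx w (List.mem_cons_of_mem _ hw)
    have h1 : combDivPow i.val k n (z :: x) =
        (((tailDivPow i.val k n z.2.2).filter fun w => w.2.sum ≤ 4).map fun w =>
          (z.1, z.2.1 + w.1, w.2)) ++ combDivPow i.val k n x := rfl
    rw [h1, toFock_append, toFock_cons, map_add, map_smul, add_sub_add_comm]
    refine Submodule.add_mem _ ?_ ih
    rw [divPow_bracket (hx z List.mem_cons_self)]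
    generalize tailDivPow i.val k n z.2.2 = L
    induction L with
    | nil => simp [toFock]
    | cons w L ihL =>
      rw [List.map_cons, List.sum_cons, smul_add, smul_smul, mul_assoc,
        ← LaurentPolynomial.T_add]
      by_cases hw : w.2.sum ≤ 4
      · rw [List.filter_cons_of_pos (by simpa using hw), List.map_cons, toFock_cons,
          add_sub_add_left_eq_sub]
        exact ihL
      · rw [List.filter_cons_of_neg (by simpa using hw), add_sub_assoc]
        exact Submodule.add_mem _
          (Submodule.smul_mem _ _ (bracket_mem_fockGT (by omega))) ihL

theorem combDivPow_red (i k n : ℕ) (c : List ℕ) (m : ℕ) :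
    combDivPow i k (red n) (colComb m c) = combDivPow i k n (colComb m c) := by
  refine List.flatMap_congr fun z hz => ?_
  rw [tailDivPow_red _ _ _ _ (sum_le_of_mem_tailList (mem_colComb hz).1)]

theorem combDivPow_eq_nil {i k n : ℕ} {m : ℕ} {c : List ℕ} (hk : 7 ≤ k) :
    combDivPow i k n (colComb m c) = [] := by
  refine List.flatMap_eq_nil_iff.2 fun z hz => ?_
  have h1 := length_le_of_mem_tailList (mem_colComb hz).1
  have h2 : (addRows (rowFun n z.2.2) (z.2.2.length + 1) i).length ≤ z.2.2.length + 1 + 1 := by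
    exact (List.length_filter_le _ _).trans_eq List.length_range
  rw [tailDivPow, List.sublistsLen_of_length_lt (by omega)]
  rfl

theorem colsAt_red (n : ℕ) : colsAt (red n) = colsAt n := by
  refine List.filter_congr fun c hc => decide_eq_decide.2 ?_
  have h : ∀ c ∈ regTails, c.sum + c.headD 0 + 1 ≤ 10 := by decide
  have h1 := le_red_iff (n := n) (h c hc)
  rw [← Nat.succ_le_iff, ← Nat.succ_le_iff]
  simp only [Nat.succ_eq_add_one, h1]

/-- The divided powers map columns to combinations of columns with coefficients invariant under
`q ↦ q⁻¹`, modulo `𝓕^{>4}`. -/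
theorem divPow_colVec (i : ZMod 2) (k n : ℕ) {c : List ℕ} (hc : c ∈ colsAt n) :
    ∃ y ∈ barSpan (n + k) (colsAt (n + k)), divPow 2 i k (colVec n c) - y ∈ fockGT 4 := by
  refine ⟨_, ?_, divPow_toFock_sub_mem i k n _ fun z hz => isTailOf_of_mem_colComb hz⟩
  by_cases hk : 7 ≤ k
  · rw [combDivPow_eq_nil hk]
    exact AddSubgroup.zero_mem _
  · have h := columnsStable_all
    simp only [columnsStable, List.all_eq_true, List.mem_range] at h
    have h1 := h (red n) (red_lt n) c (by rwa [colsAt_red]) i.val (ZMod.val_lt i) k (by omega)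
    rw [red_red_add, colsAt_red, combDivPow_red] at h1
    rw [← toFock_collect]
    exact toFock_mem_barSpan _ _ h1

/-! ### Laurent polynomials of positive order -/

/-- `f ∈ q ^ d ℤ[q]`. -/
def OrderGE (d : ℤ) (f : ℤ[T;T⁻¹]) : Prop :=
  ∃ p : Polynomial ℤ, f = Polynomial.toLaurent p * LaurentPolynomial.T d

theorem OrderGE.zero (d : ℤ) : OrderGE d 0 := ⟨0, by simp⟩

theorem OrderGE.add {d : ℤ} {f g : ℤ[T;T⁻¹]} (hf : OrderGE d f) (hg : OrderGE d g) :
    OrderGE d (f + g) := by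
  obtain ⟨a, rfl⟩ := hf
  obtain ⟨b, rfl⟩ := hg
  exact ⟨a + b, by rw [map_add, add_mul]⟩

theorem OrderGE.neg {d : ℤ} {f : ℤ[T;T⁻¹]} (hf : OrderGE d f) : OrderGE d (-f) := by
  obtain ⟨a, rfl⟩ := hf
  exact ⟨-a, by rw [map_neg, neg_mul]⟩

theorem OrderGE.sub {d : ℤ} {f g : ℤ[T;T⁻¹]} (hf : OrderGE d f) (hg : OrderGE d g) :
    OrderGE d (f - g) := by
  rw [sub_eq_add_neg]
  exact hf.add hg.neg

theorem OrderGE.mul {d e : ℤ} {f g : ℤ[T;T⁻¹]} (hf : OrderGE d f) (hg : OrderGE e g) :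
    OrderGE (d + e) (f * g) := by
  obtain ⟨a, rfl⟩ := hf
  obtain ⟨b, rfl⟩ := hg
  refine ⟨a * b, ?_⟩
  rw [map_mul, LaurentPolynomial.T_add]
  ring

theorem OrderGE.mono {d e : ℤ} {f : ℤ[T;T⁻¹]} (hf : OrderGE d f) (h : e ≤ d) : OrderGE e f := by
  obtain ⟨a, rfl⟩ := hf
  obtain ⟨m, hm⟩ := Int.eq_ofNat_of_zero_le (sub_nonneg.2 h)
  refine ⟨a * Polynomial.X ^ m, ?_⟩
  rw [map_mul, map_pow, Polynomial.toLaurent_X, LaurentPolynomial.T_pow, mul_assoc,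
    ← LaurentPolynomial.T_add]
  congr 2
  simp at hm ⊢
  omega

theorem OrderGE.sum {ι : Type*} {d : ℤ} (s : Finset ι) (f : ι → ℤ[T;T⁻¹])
    (h : ∀ i ∈ s, OrderGE d (f i)) : OrderGE d (∑ i ∈ s, f i) :=
  Finset.sum_induction f (OrderGE d) (fun _ _ => OrderGE.add) (OrderGE.zero d) h

theorem OrderGE.C_mul_T (a : ℤ) {d e : ℤ} (h : d ≤ e) :
    OrderGE d (LaurentPolynomial.C a * LaurentPolynomial.T e) :=
  OrderGE.mono (d := e) ⟨Polynomial.C a, by rw [Polynomial.toLaurent_C]⟩ h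

theorem exists_orderGE (f : ℤ[T;T⁻¹]) : ∃ n : ℕ, OrderGE (-n) f := by
  obtain ⟨n, p, hp⟩ := LaurentPolynomial.exists_T_pow f
  refine ⟨n, p, ?_⟩
  rw [hp, mul_assoc, ← LaurentPolynomial.T_add]
  simp

theorem orderGE_one_iff {f : ℤ[T;T⁻¹]} :
    OrderGE 1 f ↔ ∃ g : Polynomial ℤ, f = Polynomial.toLaurent (Polynomial.X * g) := by
  refine exists_congr fun g => ?_
  rw [map_mul, Polynomial.toLaurent_X, mul_comm]

/-- A Laurent polynomial in `qℤ[q]` whose image under `q ↦ q⁻¹` is in `qℤ[q]` vanishes. -/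
theorem eq_zero_of_orderGE_one {f : ℤ[T;T⁻¹]} (h : OrderGE 1 f)
    (h' : OrderGE 1 (LaurentPolynomial.invert f)) : f = 0 := by
  obtain ⟨a, ha⟩ := h
  obtain ⟨b, hb⟩ := h'
  have h1 : f = LaurentPolynomial.invert (Polynomial.toLaurent b) * LaurentPolynomial.T (-1) := by
    rw [← LaurentPolynomial.invert_T, ← map_mul, ← hb]
    exact (LaurentPolynomial.involutive_invert f).symm
  -- both sides are `f` times `q ^ (d + 1)`, where `d` is the degree of `b`
  have h2 : Polynomial.toLaurent (a * Polynomial.X ^ (b.natDegree + 2)) =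
      Polynomial.toLaurent b.reverse := by
    rw [LaurentPolynomial.toLaurent_reverse, map_mul, map_pow, Polynomial.toLaurent_X,
      LaurentPolynomial.T_pow]
    calc _ = f * LaurentPolynomial.T (b.natDegree + 1) := by
          rw [ha, mul_assoc, ← LaurentPolynomial.T_add]
          congr 2
          push_cast
          ring
      _ = _ := by
          rw [h1, mul_assoc, ← LaurentPolynomial.T_add]
          congr 2
          ring
  have h3 := Polynomial.toLaurent_injective h2
  have h4 : a = 0 := by
    by_contra h0
    have h5 := congrArg Polynomial.natDegree h3
    rw [Polynomial.natDegree_mul_X_pow _ h0] at h5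
    have h6 := Polynomial.reverse_natDegree_le b
    omega
  rw [ha, h4, map_zero, zero_mul]

/-! ### Unitriangular families -/

/-- If a combination of vectors `C_j`, each congruent modulo `qℤ[q]` to a partition and those
partitions being distinct, has its truncation in the `qℤ[q]`-lattice, then so are its
coefficients: a term of lowest order of a coefficient could not cancel. -/
theorem orderGE_one_of_sum {J : Type*} {m : ℕ} (C : J → Fock) (lead : J → YoungDiagram)
    (hinj : Function.Injective lead) (htr : ∀ j, InTrunc m (lead j))
    (hC : ∀ j, InQLattice (C j - ket (lead j))) (s : Finset J) (g : J → ℤ[T;T⁻¹])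
    (hg : ∀ j ∉ s, g j = 0) {y : Fock} (hy : InQLattice y)
    (h : (∑ j ∈ s, g j • C j) - y ∈ fockGT m) (j : J) : OrderGE 1 (g j) := by
  have hCo : ∀ i l, OrderGE 1 ((C i - ket (lead i)) l) := fun i l => orderGE_one_iff.2 (hC i l)
  have hstep : ∀ d : ℤ, d ≤ 0 → (∀ j, OrderGE d (g j)) → ∀ j, OrderGE (d + 1) (g j) := by
    intro d hd hall j
    by_cases hj : j ∈ s
    swap
    · rw [hg j hj]
      exact OrderGE.zero _
    have h1 := mem_fockGT.1 h (lead j) (htr j)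
    have h2 : g j = y (lead j) - ∑ i ∈ s, g i * (C i - ket (lead i)) (lead j) := by
      have h3 : ∑ i ∈ s, g i * ket (lead i) (lead j) = g j := by
        rw [Finset.sum_eq_single_of_mem j hj]
        · simp [ket]
        · intro i _ hij
          rw [ket, Finsupp.single_eq_of_ne fun h => hij (hinj h.symm), mul_zero]
      have h4 : (∑ i ∈ s, g i • C i) (lead j) = ∑ i ∈ s, g i * C i (lead j) := by
        rw [Finsupp.finsetSum_apply]
        rfl
      rw [Finsupp.sub_apply, h4, sub_eq_zero] at h1
      rw [← h1, ← Finset.sum_sub_distrib, ← h3]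
      refine Finset.sum_congr rfl fun i _ => ?_
      rw [Finsupp.sub_apply]
      ring
    rw [h2]
    refine ((orderGE_one_iff.2 (hy _)).mono (by omega)).sub (OrderGE.sum _ _ fun i _ => ?_)
    exact (hall i).mul (hCo i _)
  obtain ⟨n, hn⟩ : ∃ n : ℕ, ∀ j, OrderGE (-n) (g j) := by
    choose N hN using exists_orderGE
    refine ⟨s.sup fun j => N (g j), fun j => ?_⟩
    by_cases hj : j ∈ s
    · refine (hN (g j)).mono ?_
      have := Finset.le_sup (f := fun j => N (g j)) hj
      omega
    · rw [hg j hj]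
      exact OrderGE.zero _
  have hind : ∀ k : ℕ, k ≤ n + 1 → ∀ j, OrderGE (-n + k) (g j) := by
    intro k
    induction k with
    | zero => simpa using fun j => hn j
    | succ k ih =>
      intro hk
      have := hstep (-n + k) (by omega) (ih (by omega))
      simpa [add_assoc] using this
  have := hind (n + 1) le_rfl j
  simpa using this

/-! ### The bar involution modulo truncation -/

/-- The degrees and tails of the `2`-regular partitions in question. -/
abbrev ColIndex : Type := {x : ℕ × List ℕ // x.2 ∈ colsAt x.1}

/-- `x` and `y` are congruent modulo `𝓕^{>4}` to `∑ f_j C_j` and `∑ f̄_j C_j`, for some Laurent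
polynomials `f_j` and the columns `C_j`. -/
inductive BarPair : Fock → Fock → Prop
  | col {n : ℕ} {c : List ℕ} (hc : c ∈ colsAt n) (f : ℤ[T;T⁻¹]) :
    BarPair (f • colVec n c) (LaurentPolynomial.invert f • colVec n c)
  | trunc {x y : Fock} (hx : x ∈ fockGT 4) (hy : y ∈ fockGT 4) : BarPair x y
  | add {x y x' y' : Fock} (h : BarPair x y) (h' : BarPair x' y') : BarPair (x + x') (y + y')

theorem BarPair.zero : BarPair 0 0 := trunc (Submodule.zero_mem _) (Submodule.zero_mem _)

theorem BarPair.smul (f : ℤ[T;T⁻¹]) {x y : Fock} (h : BarPair x y) :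
    BarPair (f • x) (LaurentPolynomial.invert f • y) := by
  induction h with
  | col hc g =>
    rw [smul_smul, smul_smul, ← map_mul]
    exact col hc _
  | trunc hx hy => exact trunc (Submodule.smul_mem _ _ hx) (Submodule.smul_mem _ _ hy)
  | add _ _ h h' =>
    rw [smul_add, smul_add]
    exact h.add h'

theorem BarPair.neg {x y : Fock} (h : BarPair x y) : BarPair (-x) (-y) := by
  have := h.smul (-1)
  rwa [map_neg, map_one, neg_one_smul, neg_one_smul] at this

theorem BarPair.of_mem_barSpan {n : ℕ} {y : Fock} (hy : y ∈ barSpan n (colsAt n)) :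
    BarPair y y := by
  induction hy using AddSubgroup.closure_induction with
  | mem y hy =>
    obtain ⟨c, hc, g, hg, rfl⟩ := hy
    have := BarPair.col hc g
    rwa [hg] at this
  | zero => exact BarPair.zero
  | add x y _ _ hx hy => exact hx.add hy
  | neg x _ hx => exact hx.neg

theorem BarPair.divPow (i : ZMod 2) (k : ℕ) {x y : Fock} (h : BarPair x y) :
    BarPair (divPow 2 i k x) (divPow 2 i k y) := by
  induction h with
  | @col n c hc f =>
    obtain ⟨y, hy, h⟩ := divPow_colVec i k n hc
    have h1 := ((BarPair.of_mem_barSpan hy).add (BarPair.trunc h h)).smul f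
    rw [add_sub_cancel] at h1
    rwa [map_smul, map_smul]
  | trunc hx hy => exact trunc (divPow_mem_fockGT hx) (divPow_mem_fockGT hy)
  | add _ _ h h' =>
    rw [map_add, map_add]
    exact h.add h'

/-- The pairs in the graph of the bar involution of `U` preserve the relation. -/
theorem BarPair.barGraph {u : Module.End ℤ[T;T⁻¹] Fock × Module.End ℤ[T;T⁻¹] Fock}
    (hu : u ∈ barGraph 2) {x y : Fock} (h : BarPair x y) : BarPair (u.1 x) (u.2 y) := by
  induction hu using Subring.closure_induction generalizing x y with
  | mem u hu =>
    rcases hu with ⟨⟨i, k⟩, rfl⟩ | ⟨f, rfl⟩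
    · exact h.divPow i k
    · exact h.smul f
  | zero => exact BarPair.zero
  | one => exact h
  | add u v _ _ hu hv => exact (hu h).add (hv h)
  | neg u _ hu => exact (hu h).neg
  | mul u v _ _ hu hv => exact hu (hv h)

/-- The column with the given index. -/
noncomputable def colOf (j : ColIndex) : Fock := colVec j.1.1 j.1.2

theorem BarPair.exists_coeffs {x y : Fock} (h : BarPair x y) :
    ∃ f : ColIndex →₀ ℤ[T;T⁻¹],
      Finsupp.linearCombination ℤ[T;T⁻¹] colOf f - x ∈ fockGT 4 ∧
      Finsupp.linearCombination ℤ[T;T⁻¹] colOf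
        (f.mapRange LaurentPolynomial.invert (map_zero _)) - y ∈ fockGT 4 := by
  induction h with
  | @col n c hc f =>
    refine ⟨Finsupp.single ⟨(n, c), hc⟩ f, ?_⟩
    simp [Finsupp.mapRange_single, Finsupp.linearCombination_single, colOf]
  | trunc hx hy => exact ⟨0, by simpa using hx, by simpa using hy⟩
  | add _ _ h h' =>
    obtain ⟨f, hf1, hf2⟩ := h
    obtain ⟨g, hg1, hg2⟩ := h'
    refine ⟨f + g, ?_, ?_⟩
    · rw [map_add, add_sub_add_comm]
      exact Submodule.add_mem _ hf1 hg1
    · rw [Finsupp.mapRange_add (map_add _), map_add, add_sub_add_comm]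
      exact Submodule.add_mem _ hf2 hg2

/-! ### The columns are congruent to partitions -/

theorem inQLattice_iff {x : Fock} : InQLattice x ↔ ∀ l, OrderGE 1 (x l) :=
  forall_congr' fun _ => orderGE_one_iff.symm

theorem InQLattice.sub {x y : Fock} (hx : InQLattice x) (hy : InQLattice y) :
    InQLattice (x - y) := by
  rw [inQLattice_iff] at *
  exact fun l => (hx l).sub (hy l)

theorem inQLattice_toFock (n : ℕ) (x : Comb) (hx : ∀ z ∈ x, 0 < z.2.1) :
    InQLattice (toFock n x) := by
  classical
  rw [inQLattice_iff]
  intro l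
  induction x with
  | nil => exact OrderGE.zero _
  | cons z x ih =>
    rw [toFock_cons, Finsupp.add_apply, Finsupp.smul_apply, smul_eq_mul]
    refine OrderGE.add ?_ (ih fun w hw => hx w (List.mem_cons_of_mem _ hw))
    have h1 : OrderGE 0 (bracket n z.2.2 l) := by
      rw [bracket]
      split_ifs with h
      · rw [ket, Finsupp.single_apply]
        split_ifs
        · exact ⟨1, by simp⟩
        · exact OrderGE.zero _
      · exact OrderGE.zero _
    have h2 := (OrderGE.C_mul_T z.1 (d := 1) (e := z.2.1)
      (by have := hx z List.mem_cons_self; omega)).mul h1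
    rwa [add_zero] at h2

theorem mem_colsAt {n : ℕ} {c : List ℕ} :
    c ∈ colsAt n ↔ c ∈ regTails ∧ (c = [] ∨ c.sum + c.headD 0 < n) := by
  simp [colsAt]

theorem isTailOf_of_mem_colsAt {n : ℕ} {c : List ℕ} (hc : c ∈ colsAt n) : IsTailOf n c := by
  obtain ⟨h1, h2⟩ := mem_colsAt.1 hc
  have h3 : ∀ c ∈ regTails, c ∈ tailList := by decide
  refine isTailOf_of_mem_tailList (h3 c h1) ?_
  rcases h2 with rfl | h2
  · simp
  · exact h2.le

/-- The `2`-regular partition that belongs to a column. -/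
def leadOf (j : ColIndex) : YoungDiagram :=
  YoungDiagram.ofRowLens _ (isTailOf_of_mem_colsAt j.2).2

theorem bracket_eq_ket_leadOf (j : ColIndex) : bracket j.1.1 j.1.2 = ket (leadOf j) := by
  rw [bracket, dif_pos (isTailOf_of_mem_colsAt j.2).2]
  rfl

theorem leadOf_injective : Function.Injective leadOf := by
  rintro ⟨⟨n, c⟩, hc⟩ ⟨⟨n', c'⟩, hc'⟩ h
  have hr : ∀ r, ((n - c.sum) :: c).getD r 0 = ((n' - c'.sum) :: c').getD r 0 := fun r => by
    have := congrArg (fun l => l.rowLen r) h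
    simpa only [leadOf, rowLen_ofRowLens_eq_getD] using this
  have key : ∀ c ∈ regTails, ∀ c' ∈ regTails, c.getD 0 0 = c'.getD 0 0 →
      c.getD 1 0 = c'.getD 1 0 → c = c' := by decide
  obtain rfl := key c (mem_colsAt.1 hc).1 c' (mem_colsAt.1 hc').1 (hr 1) (hr 2)
  have h1 := (isTailOf_of_mem_colsAt hc).1
  have h2 := (isTailOf_of_mem_colsAt hc').1
  have h3 : n - c.sum = n' - c.sum := hr 0
  obtain rfl : n = n' := by
    simp only at h1 h2
    omega
  rfl

theorem inTrunc_leadOf (j : ColIndex) : InTrunc 4 (leadOf j) := by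
  have h : ∀ c ∈ regTails, c.sum ≤ 4 := by decide
  have h1 := h _ (mem_colsAt.1 j.2).1
  rw [InTrunc, leadOf, card_ofRowLens, rowLen_ofRowLens_eq_getD, List.sum_cons,
    List.getD_cons_zero]
  omega

theorem colComb_leading : ∀ n ∈ List.range 12, ∀ c ∈ colsAt n,
    (1, 0, c) ∈ colComb n c ∧ ∀ z ∈ (colComb n c).erase (1, 0, c), 0 < z.2.1 := by
  decide +kernel

theorem inQLattice_colOf_sub (j : ColIndex) : InQLattice (colOf j - ket (leadOf j)) := by
  obtain ⟨h1, h2⟩ := colComb_leading (red j.1.1) (List.mem_range.2 (red_lt _)) j.1.2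
    (by rw [colsAt_red]; exact j.2)
  rw [colOf, colVec, toFock_perm _ (List.perm_cons_erase h1), toFock_cons,
    ← bracket_eq_ket_leadOf]
  simpa using inQLattice_toFock j.1.1 _ h2

/-! ### Bar-invariant elements -/

theorem bracket_zero_nil : bracket 0 [] = ket ⊥ := by
  refine bracket_eq_ket fun r => ?_
  have h : (⊥ : YoungDiagram).rowLen r = 0 := by
    by_contra h
    exact YoungDiagram.notMem_bot _
      (YoungDiagram.mem_iff_lt_rowLen.2 (Nat.pos_of_ne_zero h))
  rw [h]
  cases r <;> simp [rowFun]

theorem colVec_zero_nil : colVec 0 [] = ket ⊥ := by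
  have h : colComb (red 0) [] = [(1, 0, [])] := by decide
  rw [colVec, h, toFock_cons, toFock_nil, bracket_zero_nil]
  simp

theorem nil_mem_colsAt (n : ℕ) : [] ∈ colsAt n := mem_colsAt.2 ⟨by decide, Or.inl rfl⟩

/-- A bar-invariant element whose truncation lies in the `qℤ[q]`-lattice has truncation zero. -/
theorem IsBarInvariant.mem_fockGT {z y : Fock} (hz : IsBarInvariant 2 z) (hy : InQLattice y)
    (h : z - y ∈ fockGT 4) : z ∈ fockGT 4 := by
  obtain ⟨u, hu, hu1, hu2⟩ := hz
  have h1 : BarPair (ket ⊥) (ket ⊥) := by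
    have := BarPair.col (nil_mem_colsAt 0) 1
    rwa [map_one, one_smul, colVec_zero_nil] at this
  have h2 := h1.barGraph hu
  rw [hu1, hu2] at h2
  obtain ⟨f, hf1, hf2⟩ := h2.exists_coeffs
  have key : ∀ g : ColIndex →₀ ℤ[T;T⁻¹],
      Finsupp.linearCombination ℤ[T;T⁻¹] colOf g - z ∈ fockGT 4 → ∀ j, OrderGE 1 (g j) := by
    intro g hg
    refine orderGE_one_of_sum colOf leadOf leadOf_injective inTrunc_leadOf inQLattice_colOf_sub
      g.support g (fun j hj => Finsupp.notMem_support_iff.1 hj) hy ?_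
    have := Submodule.add_mem _ hg h
    rwa [sub_add_sub_cancel] at this
  have hf : f = 0 := by
    ext1 j
    exact eq_zero_of_orderGE_one (key f hf1 j) (key _ hf2 j)
  rw [hf, map_zero, zero_sub, neg_mem_iff] at hf1
  exact hf1

theorem IsBarInvariant.add {x y : Fock} (hx : IsBarInvariant 2 x) (hy : IsBarInvariant 2 y) :
    IsBarInvariant 2 (x + y) := by
  obtain ⟨u, hu, rfl, hu2⟩ := hx
  obtain ⟨v, hv, rfl, hv2⟩ := hy
  exact ⟨u + v, add_mem hu hv, rfl, congrArg₂ (· + ·) hu2 hv2⟩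

theorem IsBarInvariant.smul {f : ℤ[T;T⁻¹]} (hf : LaurentPolynomial.invert f = f) {x : Fock}
    (hx : IsBarInvariant 2 x) : IsBarInvariant 2 (f • x) := by
  obtain ⟨u, hu, rfl, hu2⟩ := hx
  refine ⟨_, mul_mem (Subring.subset_closure (Or.inr ⟨f, rfl⟩)) hu, rfl, ?_⟩
  change LaurentPolynomial.invert f • u.2 (ket ⊥) = _
  rw [hf, hu2]

theorem IsBarInvariant.neg {x : Fock} (hx : IsBarInvariant 2 x) : IsBarInvariant 2 (-x) := by
  have := hx.smul (f := -1) (by rw [map_neg, map_one])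
  rwa [neg_one_smul] at this

theorem IsBarInvariant.sub {x y : Fock} (hx : IsBarInvariant 2 x) (hy : IsBarInvariant 2 y) :
    IsBarInvariant 2 (x - y) := by
  rw [sub_eq_add_neg]
  exact hx.add hy.neg

theorem IsBarInvariant.divPow (i : ZMod 2) (k : ℕ) {x : Fock} (hx : IsBarInvariant 2 x) :
    IsBarInvariant 2 (divPow 2 i k x) := by
  obtain ⟨u, hu, rfl, hu2⟩ := hx
  exact ⟨_, mul_mem (Subring.subset_closure (Or.inl ⟨(i, k), rfl⟩)) hu, rfl,
    congrArg (FockSpace.divPow 2 i k) hu2⟩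

theorem isBarInvariant_ket_bot : IsBarInvariant 2 (ket ⊥) := ⟨1, one_mem _, rfl, rfl⟩

/-- `x` is congruent to a bar-invariant element modulo `𝓕^{>4}`. -/
def IsBarInvariantModGT (x : Fock) : Prop :=
  ∃ y, IsBarInvariant 2 y ∧ y - x ∈ fockGT 4

theorem IsBarInvariantModGT.sub {x y : Fock} (hx : IsBarInvariantModGT x)
    (hy : IsBarInvariantModGT y) : IsBarInvariantModGT (x - y) := by
  obtain ⟨a, ha, ha'⟩ := hx
  obtain ⟨b, hb, hb'⟩ := hy
  refine ⟨a - b, ha.sub hb, ?_⟩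
  rw [sub_sub_sub_comm]
  exact Submodule.sub_mem _ ha' hb'

theorem IsBarInvariantModGT.smul {f : ℤ[T;T⁻¹]} (hf : LaurentPolynomial.invert f = f) {x : Fock}
    (hx : IsBarInvariantModGT x) : IsBarInvariantModGT (f • x) := by
  obtain ⟨a, ha, ha'⟩ := hx
  refine ⟨f • a, ha.smul hf, ?_⟩
  rw [← smul_sub]
  exact Submodule.smul_mem _ _ ha'

theorem IsBarInvariantModGT.divPow (i : ZMod 2) (k : ℕ) {x : Fock}
    (hx : IsBarInvariantModGT x) : IsBarInvariantModGT (divPow 2 i k x) := by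
  obtain ⟨a, ha, ha'⟩ := hx
  refine ⟨_, ha.divPow i k, ?_⟩
  rw [← map_sub]
  exact divPow_mem_fockGT ha'

theorem IsBarInvariantModGT.congr {x y : Fock} (hx : IsBarInvariantModGT x)
    (h : x - y ∈ fockGT 4) : IsBarInvariantModGT y := by
  obtain ⟨a, ha, ha'⟩ := hx
  refine ⟨a, ha, ?_⟩
  have := Submodule.add_mem _ ha' h
  rwa [sub_add_sub_cancel] at this

theorem isBarInvariantModGT_of_mem_barSpan {n : ℕ} {cs : List (List ℕ)}
    (hcs : ∀ c ∈ cs, IsBarInvariantModGT (colVec n c)) {y : Fock} (hy : y ∈ barSpan n cs) :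
    IsBarInvariantModGT y := by
  have h0 : IsBarInvariantModGT 0 := by
    refine ⟨(0 : ℤ[T;T⁻¹]) • ket ⊥, isBarInvariant_ket_bot.smul (map_zero _), ?_⟩
    simp
  induction hy using AddSubgroup.closure_induction with
  | mem y hy =>
    obtain ⟨c, hc, f, hf, rfl⟩ := hy
    exact (hcs c hc).smul hf
  | zero => exact h0
  | add x y _ _ hx hy =>
    have := hx.sub (h0.sub hy)
    rwa [zero_sub, sub_neg_eq_add] at this
  | neg x _ hx =>
    have := h0.sub hx
    rwa [zero_sub] at this

/-- Each column comes from a column of smaller degree by a divided power, up to later columns of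
the same degree. -/
theorem exists_divPow_sub_mem {N : ℕ} (hN : 0 < N) {c : List ℕ} (hc : c ∈ colsAt N) :
    ∃ n < N, ∃ c' ∈ colsAt n, ∃ (i : ZMod 2) (k : ℕ), ∃ y ∈ barSpan N
      ((colsAt N).filter fun c'' => regTails.idxOf c < regTails.idxOf c''),
      divPow 2 i k (colVec n c') - (colVec N c + y) ∈ fockGT 4 := by
  -- `N'` is the degree at which the computation is done. Beyond degree `10` only `k = 1` is used,
  -- so that the predecessor, of degree at least `10`, reduces to `N' - 1`.
  obtain ⟨N', hN0, hN', hred, hpred⟩ : ∃ N', 0 < N' ∧ N' ≤ 12 ∧ red N' = red N ∧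
      ∀ k, 0 < k → k ≤ N' → (N' ≤ 10 ∨ k = 1) → k ≤ N ∧ red (N - k) = N' - k := by
    by_cases h : N ≤ 10
    · exact ⟨N, hN, by omega, rfl, fun k _ hk _ => ⟨hk, red_of_lt (by omega)⟩⟩
    · refine ⟨11 + (N - 11) % 2, by omega, by omega, ?_, ?_⟩
      · simp only [red]
        split_ifs <;> omega
      · intro k h0 hk hk'
        refine ⟨by omega, ?_⟩
        simp only [red]
        split_ifs <;> omega
  have hcols : colsAt N' = colsAt N := by rw [← colsAt_red, hred, colsAt_red]
  have h := columnsReached_all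
  simp only [columnsReached, List.all_eq_true, List.any_eq_true, List.mem_range, Bool.and_eq_true,
    Bool.or_eq_true, decide_eq_true_eq] at h
  have h1 := h (N' - 1) (by omega)
  rw [Nat.sub_add_cancel hN0] at h1
  obtain ⟨k, hk, i, hi, ⟨hkN, hk'⟩, c', hc', hsp⟩ := h1 c (by rwa [hcols])
  have hk0 : 0 < k := by
    simp only [List.mem_cons, List.not_mem_nil, or_false] at hk
    omega
  obtain ⟨hkN', hredk⟩ := hpred k hk0 hkN hk'
  rw [hcols, hred, ← hredk] at hsp
  rw [← hredk, colsAt_red] at hc'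
  have h2 := toFock_mem_barSpan _ _ hsp
  have hneg : evalPoly [(-1, 0)] = -1 := by simp [evalPoly]
  rw [toFock_collect, toFock_append, toFock_mulComb, hneg, neg_one_smul, combDivPow_red] at h2
  refine ⟨N - k, by omega, c', hc', i, k, _, h2, ?_⟩
  have h3 := divPow_toFock_sub_mem (i : ZMod 2) k (N - k) (colComb (red (N - k)) c')
    fun z hz => isTailOf_of_mem_colComb hz
  rw [ZMod.val_natCast_of_lt hi, Nat.sub_add_cancel hkN'] at h3
  have h4 : ∀ a b : Fock, a + (b + -a) = b := fun a b => by abel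
  rw [← colVec, h4]
  exact h3

theorem isBarInvariantModGT_colVec (N : ℕ) {c : List ℕ} (hc : c ∈ colsAt N) :
    IsBarInvariantModGT (colVec N c) := by
  induction N using Nat.strong_induction_on generalizing c with
  | _ N ih =>
    rcases N.eq_zero_or_pos with rfl | hN
    · have h : ∀ c ∈ colsAt 0, c = [] := by decide
      rw [h c hc, colVec_zero_nil]
      exact ⟨_, isBarInvariant_ket_bot, by simp⟩
    · have key : ∀ m : ℕ, ∀ c ∈ colsAt N, 7 - regTails.idxOf c ≤ m →
          IsBarInvariantModGT (colVec N c) := by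
        intro m
        induction m with
        | zero =>
          intro c hc hm
          have h1 := List.idxOf_lt_length_iff.2 (mem_colsAt.1 hc).1
          have h2 : regTails.length = 7 := rfl
          omega
        | succ m ihm =>
          intro c hc hm
          obtain ⟨n, hn, c', hc', i, k, y, hy, h⟩ := exists_divPow_sub_mem hN hc
          have h1 := ((ih n hn hc').divPow i k).congr h
          have h2 : IsBarInvariantModGT y := by
            refine isBarInvariantModGT_of_mem_barSpan (fun c'' hc'' => ?_) hy
            simp only [List.mem_filter, decide_eq_true_eq] at hc''
            exact ihm c'' hc''.1 (by omega)
          have h3 := h1.sub h2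
          rwa [add_sub_cancel_right] at h3
      exact key _ c hc le_rfl

/-! ### Comparison with the table -/

theorem tails_eq : tails = tailList.toFinset := rfl

theorem toFock_flatMap_filter (n : ℕ) (L : List (List ℕ)) (p : List ℕ → Prop) [DecidablePred p]
    (P : List ℕ → Poly) :
    toFock n ((L.filter fun r => p r).flatMap fun r => (P r).map fun a => (a.1, a.2, r)) =
      (L.map fun r => if p r then evalPoly (P r) • bracket n r else 0).sum := by
  induction L with
  | nil => rfl
  | cons r L ih =>
    rw [List.map_cons, List.sum_cons, ← ih]
    by_cases h : p r
    · rw [List.filter_cons_of_pos (by simpa using h), List.flatMap_cons, toFock_append,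
        toFock_map_tail, if_pos h]
    · rw [List.filter_cons_of_neg (by simpa using h), if_neg h, zero_add]

theorem entry_red (n : ℕ) (r c : List ℕ) : entry (red n) r c = entry n r c := by
  unfold entry delta
  rw [red_mod_two]

theorem evalPoly_nil : evalPoly [] = 0 := rfl

theorem evalPoly_single (e : ℤ) : evalPoly [(1, e)] = LaurentPolynomial.T e := by
  simp [evalPoly]

theorem evalPoly_append (p p' : Poly) : evalPoly (p ++ p') = evalPoly p + evalPoly p' := by
  simp [evalPoly]

theorem evalPoly_ite (P : Prop) [Decidable P] (p p' : Poly) :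
    evalPoly (if P then p else p') = if P then evalPoly p else evalPoly p' :=
  apply_ite _ _ _ _

theorem evalPoly_entryPoly {n : ℕ} {c r : List ℕ} (hc : c ∈ regTails) (hr : r ∈ tailList)
    (hn : lowerBound c ≤ n) : evalPoly (entryPoly n r c) = entry n r c := by
  simp only [regTails, List.mem_cons, List.not_mem_nil, or_false] at hc
  simp only [tailList, List.mem_cons, List.not_mem_nil, or_false] at hr
  rcases hc with rfl | rfl | rfl | rfl | rfl | rfl | rfl <;>
  · simp only [lowerBound] at hn
    have h4 : n ≠ 4 := by omega
    rcases hr with rfl | rfl | rfl | rfl | rfl | rfl | rfl | rfl | rfl | rfl | rfl | rfl <;>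
    first
    | rfl
    | (simp [entryPoly, entry, delta, q, h4, evalPoly_ite, evalPoly_nil, evalPoly_single,
        evalPoly_append, LaurentPolynomial.T_pow]
       done)
    | (have h6 : ¬ n ≤ 6 := by omega
       have h6' : n ≠ 6 := by omega
       simp [entryPoly, entry, delta, q, h6, h6', evalPoly_ite, evalPoly_nil, evalPoly_cons,
        LaurentPolynomial.T_pow])

theorem lowerBound_le_iff_red {c : List ℕ} (hc : c ∈ regTails) {n : ℕ} :
    lowerBound c ≤ red n ↔ lowerBound c ≤ n := by
  have h : ∀ c ∈ regTails, lowerBound c ≤ 10 := by decide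
  exact le_red_iff (h c hc)

theorem five_le_lowerBound {c : List ℕ} (hc : c ∈ regTails) : 5 ≤ lowerBound c := by
  revert c
  decide

/-- From the bounds in the table on, no correction of the columns is needed. -/
theorem column_eq_colVec {n : ℕ} {c : List ℕ} (hc : c ∈ regTails) (hn : lowerBound c ≤ n) :
    column n c = colVec n c := by
  rw [column, tails_eq, List.sum_toFinset _ (by decide), colVec, colComb, toFock_flatMap_filter]
  congr 1
  refine List.map_congr_left fun r hr => ?_
  rw [evalPoly_entryPoly hc hr ((lowerBound_le_iff_red hc).2 hn), entry_red]
  split_ifs with h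
  · rfl
  · have h1 : ∀ t ∈ tailList, t.sum + t.headD 0 ≤ 10 := by decide
    have h2 : ¬ r.sum + r.headD 0 ≤ n := fun h' => h ((le_red_iff (h1 r hr)).2 h')
    have h3 := sum_le_of_mem_tailList hr
    have h4 := five_le_lowerBound hc
    have h5 : ¬ ((n - r.sum) :: r).SortedGE := by
      intro h5
      cases r with
      | nil => simp at h2
      | cons a r =>
        have h6 := (List.isChain_cons_cons.1 h5.isChain).1
        simp only [List.headD_cons] at h2
        omega
    rw [bracket, dif_neg h5, smul_zero]

/-! ### The tails of truncated partitions -/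

theorem card_eq_sum_rowLens (μ : YoungDiagram) : μ.card = μ.rowLens.sum := by
  conv_lhs => rw [← YoungDiagram.ofRowLens_to_rowLens_eq_self (μ := μ)]
  exact card_ofRowLens _ _

theorem rowLen_eq_getD_rowLens (μ : YoungDiagram) (r : ℕ) :
    μ.rowLen r = μ.rowLens.getD r 0 := by
  conv_lhs => rw [← YoungDiagram.ofRowLens_to_rowLens_eq_self (μ := μ)]
  exact rowLen_ofRowLens_eq_getD _ _ r

theorem mem_tailList_of_sorted {t : List ℕ} (hs : t.SortedGE) (hpos : ∀ x ∈ t, 0 < x)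
    (hsum : t.sum ≤ 4) : t ∈ tailList := by
  have hs := hs.isChain
  rcases t with _ | ⟨a, _ | ⟨b, _ | ⟨c, _ | ⟨d, _ | ⟨e, t⟩⟩⟩⟩⟩
  · decide
  · simp only [List.mem_cons, List.not_mem_nil, or_false, forall_eq, List.sum_cons, List.sum_nil]
      at hpos hsum
    obtain h | h | h | h : a = 1 ∨ a = 2 ∨ a = 3 ∨ a = 4 := by omega
    all_goals subst h; decide
  · simp only [List.mem_cons, List.not_mem_nil, or_false, forall_eq_or_imp, forall_eq,
      List.sum_cons, List.sum_nil, List.isChain_cons_cons] at hpos hsum hs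
    obtain ⟨h1, h2⟩ | ⟨h1, h2⟩ | ⟨h1, h2⟩ | ⟨h1, h2⟩ :
      (a = 1 ∧ b = 1) ∨ (a = 2 ∧ b = 1) ∨ (a = 3 ∧ b = 1) ∨ (a = 2 ∧ b = 2) := by omega
    all_goals subst h1 h2; decide
  · simp only [List.mem_cons, List.not_mem_nil, or_false, forall_eq_or_imp, forall_eq,
      List.sum_cons, List.sum_nil, List.isChain_cons_cons] at hpos hsum hs
    obtain ⟨h1, h2, h3⟩ | ⟨h1, h2, h3⟩ :
      (a = 1 ∧ b = 1 ∧ c = 1) ∨ (a = 2 ∧ b = 1 ∧ c = 1) := by omega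
    all_goals subst h1 h2 h3; decide
  · simp only [List.mem_cons, List.not_mem_nil, or_false, forall_eq_or_imp, forall_eq,
      List.sum_cons, List.sum_nil] at hpos hsum
    obtain ⟨h1, h2, h3, h4⟩ : a = 1 ∧ b = 1 ∧ c = 1 ∧ d = 1 := by omega
    subst h1 h2 h3 h4
    decide
  · simp only [List.mem_cons, forall_eq_or_imp, List.sum_cons] at hpos hsum
    omega

/-- A truncated partition in bracket notation. -/
theorem tail_of_inTrunc {n : ℕ} {μ : YoungDiagram} (hn : μ.card = n) (h : InTrunc 4 μ) :
    tail μ ∈ tailList ∧ n = μ.rowLen 0 + (tail μ).sum ∧ bracket n (tail μ) = ket μ := by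
  have hsum := card_eq_sum_rowLens μ
  have hrow := rowLen_eq_getD_rowLens μ
  have hs := YoungDiagram.rowLens_sorted μ
  have hpos := YoungDiagram.pos_of_mem_rowLens μ
  simp only [InTrunc] at h
  rw [hn] at hsum h
  rw [tail]
  cases hw : μ.rowLens with
  | nil =>
    rw [hw] at hsum hrow
    refine ⟨by decide, by simp [hsum, hrow], bracket_eq_ket fun r => ?_⟩
    rw [hrow, hsum]
    cases r <;> simp [rowFun]
  | cons a t =>
    rw [hw] at hsum hrow hs hpos
    have h0 : μ.rowLen 0 = a := by simp [hrow]
    rw [List.sum_cons] at hsum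
    rw [List.tail_cons]
    refine ⟨mem_tailList_of_sorted ?_ (fun x hx => hpos x (List.mem_cons_of_mem _ hx)) (by omega),
      by omega, bracket_eq_ket fun r => ?_⟩
    · exact hs.pairwise.of_cons.sortedGE
    · rw [hrow, rowFun, show n - t.sum = a by omega]

theorem tail_mem_colsAt {n : ℕ} {μ : RegularPartition 2} (hn : μ.1.card = n)
    (h : InTrunc 4 μ.1) : tail μ.1 ∈ colsAt n := by
  obtain ⟨h1, h2, -⟩ := tail_of_inTrunc hn h
  have hrow := rowLen_eq_getD_rowLens μ.1
  have hs := YoungDiagram.rowLens_sorted μ.1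
  have hnd : μ.1.rowLens.Nodup := by
    refine List.nodup_iff_count_le_one.2 fun x => ?_
    by_cases hx : x ∈ μ.1.rowLens
    · exact Nat.lt_succ_iff.1 (μ.2 x hx)
    · rw [List.count_eq_zero_of_not_mem hx]
      exact Nat.zero_le _
  have hreg : ∀ t ∈ tailList, t.Nodup → t ∈ regTails := by decide
  rw [mem_colsAt]
  rw [tail] at *
  refine ⟨hreg _ h1 hnd.tail, ?_⟩
  rcases hw : μ.1.rowLens with _ | ⟨a, _ | ⟨b, t⟩⟩
  · exact Or.inl rfl
  · exact Or.inl rfl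
  · right
    rw [hw] at hs hnd
    have h3 := (List.isChain_cons_cons.1 hs.isChain).1
    have h4 : a ≠ b := fun h => by simp [h] at hnd
    have h5 : μ.1.rowLen 0 = a := by simp [hrow, hw]
    rw [hw] at h2
    simp only [List.tail_cons, List.headD_cons] at h2 ⊢
    omega

theorem lowerBound_le {n : ℕ} (hn : 8 ≤ n) {c : List ℕ} (hc : c ∈ colsAt n) :
    lowerBound c ≤ n := by
  have h : ∀ c ∈ regTails, lowerBound c ≤ 8 ∨ c ≠ [] ∧ lowerBound c ≤ c.sum + c.headD 0 + 1 := by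
    decide
  obtain ⟨h1, h2⟩ := mem_colsAt.1 hc
  rcases h c h1 with h3 | ⟨h3, h4⟩
  · omega
  · rcases h2 with h2 | h2
    · exact (h3 h2).elim
    · omega

theorem bracket_apply {n : ℕ} (hn : 8 ≤ n) {l : YoungDiagram} (hl : l.card = n)
    (hT : InTrunc 4 l) {r : List ℕ} (hr : r ∈ tailList) :
    bracket n r l = if r = tail l then 1 else 0 := by
  split_ifs with h
  · rw [h, (tail_of_inTrunc hl hT).2.2, ket, Finsupp.single_eq_same]
  · rw [bracket]
    split_ifs with hs
    · have hne : YoungDiagram.ofRowLens _ hs ≠ l := by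
        rintro rfl
        have hpos : ∀ t ∈ tailList, ∀ x ∈ t, 0 < x := by decide
        have h1 := sum_le_of_mem_tailList hr
        refine h ?_
        rw [tail, YoungDiagram.rowLens_ofRowLens_eq_self, List.tail_cons]
        intro x hx
        rcases List.mem_cons.1 hx with rfl | hx
        · omega
        · exact hpos r hr x hx
      rw [ket, Finsupp.single_eq_of_ne hne.symm]
    · rfl

theorem column_apply {n : ℕ} (hn : 8 ≤ n) {l : YoungDiagram} (hl : l.card = n)
    (hT : InTrunc 4 l) (c : List ℕ) : column n c l = entry n (tail l) c := by
  have h1 : tail l ∈ tails := by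
    rw [tails_eq, List.mem_toFinset]
    exact (tail_of_inTrunc hl hT).1
  rw [column, Finsupp.finsetSum_apply, Finset.sum_eq_single_of_mem _ h1]
  · rw [Finsupp.smul_apply, bracket_apply hn hl hT (tail_of_inTrunc hl hT).1, if_pos rfl,
      smul_eq_mul, mul_one]
  · intro r hr hne
    rw [tails_eq, List.mem_toFinset] at hr
    rw [Finsupp.smul_apply, bracket_apply hn hl hT hr, if_neg hne, smul_zero]

theorem entry_congr {n n' : ℕ} (h : n ≡ n' [MOD 2]) (r c : List ℕ) :
    entry n r c = entry n' r c := by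
  have h' : n % 2 = n' % 2 := h
  unfold entry delta
  rw [h']

/-- The columns of the table are congruent to bar-invariant elements, and to their partitions up
to the `qℤ[q]`-lattice. -/
theorem column_spec {n : ℕ} {μ : RegularPartition 2} (hn : μ.1.card = n) (hT : InTrunc 4 μ.1)
    (hb : lowerBound (tail μ.1) ≤ n) : IsBarInvariantModGT (column n (tail μ.1)) ∧
      InQLattice (column n (tail μ.1) - ket μ.1) := by
  have hc := tail_mem_colsAt hn hT
  rw [column_eq_colVec (mem_colsAt.1 hc).1 hb]
  refine ⟨isBarInvariantModGT_colVec n hc, ?_⟩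
  rw [← (tail_of_inTrunc hn hT).2.2]
  have := inQLattice_colOf_sub ⟨(n, tail μ.1), hc⟩
  rwa [← bracket_eq_ket_leadOf] at this

/-- A bar-invariant element that is congruent to `μ` up to the `qℤ[q]`-lattice is congruent to
the column of `μ`. -/
theorem sub_column_mem {n : ℕ} {μ : RegularPartition 2} (hn : μ.1.card = n)
    (hT : InTrunc 4 μ.1) (hb : lowerBound (tail μ.1) ≤ n) {x y : Fock}
    (hx : IsBarInvariant 2 x) (hy : InQLattice y) (h : x - (ket μ.1 + y) ∈ fockGT 4) :
    x - column n (tail μ.1) ∈ fockGT 4 := by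
  obtain ⟨⟨z, hz, hz'⟩, hq⟩ := column_spec hn hT hb
  have h1 : x - z ∈ fockGT 4 := by
    refine (hx.sub hz).mem_fockGT (hy.sub hq) ?_
    have := Submodule.sub_mem _ h hz'
    convert this using 1
    abel
  have := Submodule.add_mem _ h1 hz'
  rwa [sub_add_sub_cancel] at this

end FockSpace

open FockSpace in
theorem mainTheorem11 :
    (∀ B : RegularPartition 2 → Fock, IsGlobalCrystalBasis 2 B →
      -- the class of `B^μ` modulo `𝓕^{>4}`
      (∀ (n : ℕ) (μ : RegularPartition 2), μ.1.card = n → InTrunc 4 μ.1 →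
        lowerBound (tail μ.1) ≤ n →
        (Submodule.Quotient.mk (B μ) : Fock ⧸ fockGT 4) =
          Submodule.Quotient.mk (column n (tail μ.1))) ∧
      -- the crystallized decomposition matrix for `n ≥ 8`
      (∀ (n : ℕ), 8 ≤ n → ∀ (l : YoungDiagram) (μ : RegularPartition 2),
        l.card = n → InTrunc 4 l → μ.1.card = n → InTrunc 4 μ.1 →
        B μ l = entry n (tail l) (tail μ.1)) ∧
      -- for `n ≥ 8` its entries only depend on `n` modulo `2`
      (∀ (n n' : ℕ), 8 ≤ n → 8 ≤ n' → n ≡ n' [MOD 2] →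
        ∀ (l l' : YoungDiagram) (μ μ' : RegularPartition 2),
        l.card = n → InTrunc 4 l → μ.1.card = n → InTrunc 4 μ.1 →
        l'.card = n' → InTrunc 4 l' → μ'.1.card = n' → InTrunc 4 μ'.1 →
        tail l = tail l' → tail μ.1 = tail μ'.1 → B μ l = B μ' l')) ∧
    -- in the truncated Fock space these classes exist and are characterized by bar-invariance
    -- and the congruence modulo `q`
    (∀ (n : ℕ) (μ : RegularPartition 2), μ.1.card = n → InTrunc 4 μ.1 →
      lowerBound (tail μ.1) ≤ n →
      ∀ v : Fock ⧸ fockGT 4,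
        v = Submodule.Quotient.mk (column n (tail μ.1)) ↔
          (∃ x : Fock, IsBarInvariant 2 x ∧ Submodule.Quotient.mk x = v) ∧
          (∃ y : Fock, InQLattice y ∧
            (Submodule.Quotient.mk (ket μ.1 + y) : Fock ⧸ fockGT 4) = v)) := by
  refine ⟨fun B hB => ?_, fun n μ hn hT hb v => ⟨?_, ?_⟩⟩
  · have h1 : ∀ (n : ℕ) (μ : RegularPartition 2), μ.1.card = n → InTrunc 4 μ.1 →
        lowerBound (tail μ.1) ≤ n → B μ - column n (tail μ.1) ∈ fockGT 4 :=
      fun n μ hn hT hb => sub_column_mem hn hT hb (hB.barInvariant μ) (hB.congr μ) (by simp)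
    have h2 : ∀ (n : ℕ), 8 ≤ n → ∀ (l : YoungDiagram) (μ : RegularPartition 2),
        l.card = n → InTrunc 4 l → μ.1.card = n → InTrunc 4 μ.1 →
        B μ l = entry n (tail l) (tail μ.1) := by
      intro n hn l μ hl hTl hμ hTμ
      have h3 := mem_fockGT.1 (h1 n μ hμ hTμ (lowerBound_le hn (tail_mem_colsAt hμ hTμ))) l hTl
      rw [Finsupp.sub_apply, sub_eq_zero] at h3
      rw [h3, column_apply hn hl hTl]
    refine ⟨fun n μ hn hT hb => (Submodule.Quotient.eq _).2 (h1 n μ hn hT hb), h2, ?_⟩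
    intro n n' hn hn' hmod l l' μ μ' hl hTl hμ hTμ hl' hTl' hμ' hTμ' htl htμ
    rw [h2 n hn l μ hl hTl hμ hTμ, h2 n' hn' l' μ' hl' hTl' hμ' hTμ', htl, htμ,
      entry_congr hmod]
  · rintro rfl
    obtain ⟨⟨z, hz, hz'⟩, hq⟩ := column_spec hn hT hb
    exact ⟨⟨z, hz, (Submodule.Quotient.eq _).2 hz'⟩,
      ⟨_, hq, by rw [add_sub_cancel]⟩⟩
  · rintro ⟨⟨x, hx, rfl⟩, ⟨y, hy, h⟩⟩
    exact (Submodule.Quotient.eq _).2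
      (sub_column_mem hn hT hb hx hy ((Submodule.Quotient.eq _).1 h.symm))
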